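/- Let $S^2\subset\mathbb{R}^3$ be the unit sphere with its surface measure $dx$ (total mass $4\pi$), and let $T=\{T(x),\ x\in S^2\}$ be a real-valued, jointly measurable, zero-mean Gaussian random field on a probability space which is isotropic, i.e. its finite-dimensional distributions are invariant under all rotations in $SO(3)$. Let $Y_{\ell m}$ ($\ell\ge 0$, $-\ell\le m\le \ell$) be the standard complex spherical harmonics, $P_\ell$ the Legendre polynomials, and put $$a_{\ell m}=\int_{S^2}T(x)\overline{Y_{\ell m}(x)}\,dx,\qquad T_\ell(x)=\sum_{m=-\ell}^{\ell}a_{\ell m}Y_{\ell m}(x),\qquad C_\ell=\frac{1}{2\ell+1}\sum_{m=-\ell}^{\ell}\mathbb{E}|a_{\ell m}|^2$$ (by isotropy $\mathbb{E}|a_{\ell m}|^2=C_\ell$ for every $m$). Let $B>1$, let $b:\mathbb{R}\to\mathbb{R}$ vanish outside $[B^{-1},B]$, let $j\ge 0$ be an integer, and let $$\beta_j(x)=\sum_{\ell}b\!\left(\tfrac{\ell}{B^j}\right)T_\ell(x),\qquad \widetilde\beta_j(x)=\frac{\beta_j(x)}{\sqrt{\sum_\ell b^2(\ell/B^j)\frac{2\ell+1}{4\pi}C_\ell}}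 .$$ Assume the normalization $\mathbb{E}\beta_j^2(x)=1$ for all $x\in S^2$. Let $L_K\in\mathbb{N}$, $\kappa(0),\dots,\kappa(L_K)\in\mathbb{R}$, $K(t)=\sum_{\ell=0}^{L_K}\frac{2\ell+1}{4\pi}\kappa(\ell)P_\ell(t)$, and, with the Hermite polynomial $H_2(u)=u^2-1$, define $$g_{j;2}(x)=\int_{S^2}K(\langle x,y\rangle)\,H_2(\widetilde\beta_j(y))\,dy,\qquad x\in S^2 .$$ Then the field $g_{j;2}$ has zero mean, finite variance and is isotropic (its finite-dimensional distributions are invariant under $SO(3)$), and for all $x_1,x_2\in S^2$ $$\mathbb{E}\{g_{j;2}(x_1)g_{j;2}(x_2)\}=2\sum_{\ell=0}^{L_K}\kappa^2(\ell)\frac{2\ell+1}{4\pi}\sum_{\ell_1,\ell_2}b^2\!\left(\tfrac{\ell_1}{B^j}\right)b^2\!\left(\tfrac{\ell_2}{B^j}\right)\frac{(2\ell_1+1)(2\ell_2+1)}{4\pi}C_{\ell_1}C_{\ell_2}\begin{pmatrix}\ell&\ell_1&\ell_2\\0&0&0\end{pmatrix}^{2}P_\ell(\langle x_1,x_2\rangle),$$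 where the bracket is Wigner's $3j$ symbol. -/

import Mathlib

open MeasureTheory ProbabilityTheory
open scoped Nat

noncomputable section

namespace SphericalField

/-- The unit sphere `S²` in Euclidean space `ℝ³`. -/
abbrev S2 : Type := Metric.sphere (0 : EuclideanSpace ℝ (Fin 3)) 1

/-- The surface measure `dx` on `S²` (total mass `4π`). -/
def surfaceMeasure : Measure S2 :=
  (volume : Measure (EuclideanSpace ℝ (Fin 3))).toSphere

/-- The action of a linear isometry of `ℝ³` on `S²`. -/
def rotate (R : EuclideanSpace ℝ (Fin 3) ≃ₗᵢ[ℝ] EuclideanSpace ℝ (Fin 3)) (x : S2) : S2 :=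
  ⟨R x, by simp⟩

/-! ### Random fields on the sphere -/

/-- (Strong) isotropy: the finite-dimensional distributions of the field are invariant under every
rotation `R ∈ SO(3)`. -/
def IsIsotropic {Ω : Type*} [MeasurableSpace Ω] (f : S2 → Ω → ℝ) (P : Measure Ω) : Prop :=
  ∀ R : EuclideanSpace ℝ (Fin 3) ≃ₗᵢ[ℝ] EuclideanSpace ℝ (Fin 3),
    LinearMap.det (R.toLinearEquiv :
      EuclideanSpace ℝ (Fin 3) →ₗ[ℝ] EuclideanSpace ℝ (Fin 3)) = 1 →
    ∀ (n : ℕ) (x : Fin n → S2),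
      IdentDistrib (fun ω i => f (rotate R (x i)) ω) (fun ω i => f (x i) ω) P P

/-- A (jointly measurable) Gaussian, zero-mean, isotropic random field on the sphere. -/
structure IsGaussianIsotropicField {Ω : Type*} [MeasurableSpace Ω] (T : S2 → Ω → ℝ)
    (P : Measure Ω) : Prop where
  measurable : Measurable (fun p : S2 × Ω => T p.1 p.2)
  gaussian : IsGaussianProcess T P
  zero_mean : ∀ x, ∫ ω, T x ω ∂P = 0
  isotropic : IsIsotropic T P

/-! ### Legendre polynomials and spherical harmonics -/

/-- The Legendre polynomial `P_ℓ = (2^ℓ ℓ!)⁻¹ d^ℓ/dt^ℓ (t² - 1)^ℓ`. -/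
def legendre (l : ℕ) : Polynomial ℝ :=
  Polynomial.C ((2 ^ l * (l ! : ℝ))⁻¹) *
    Polynomial.derivative^[l] ((Polynomial.X ^ 2 - 1) ^ l)

/-- The standard complex spherical harmonics, for `-ℓ ≤ m ≤ ℓ`: with `x = (sin θ cos φ,
sin θ sin φ, cos θ)` and `k = |m|`,
`Y_{ℓm}(x) = (±1) √((2ℓ+1)/(4π) · (ℓ-k)!/(ℓ+k)!) · P_ℓ^{(k)}(cos θ) (sin θ)^k e^{imφ}`,
where `P_ℓ^{(k)}` is the `k`-th derivative of the Legendre polynomial, and the sign is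
`(-1)^m` for `m ≥ 0` (Condon-Shortley phase) and `1` for `m < 0`. -/
def sphericalHarmonic (l : ℕ) (m : ℤ) (x : S2) : ℂ :=
  ((Real.sqrt ((2 * l + 1) / (4 * Real.pi) * ((l - m.natAbs)! / (l + m.natAbs)!)) *
      (Polynomial.derivative^[m.natAbs] (legendre l)).eval (x.1 2) : ℝ) : ℂ) *
    (if 0 ≤ m then (-1) ^ m.natAbs * ((x.1 0 : ℂ) + Complex.I * (x.1 1 : ℂ)) ^ m.natAbs
      else ((x.1 0 : ℂ) - Complex.I * (x.1 1 : ℂ)) ^ m.natAbs)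

/-! ### Harmonic components of a random field -/

section Fields

variable {Ω : Type*}

/-- The random spherical harmonic coefficient
`a_{ℓm} = ∫_{S²} T(x) conj(Y_{ℓm}(x)) dx`. -/
def harmonicCoeff (T : S2 → Ω → ℝ) (l : ℕ) (m : ℤ) (ω : Ω) : ℂ :=
  ∫ x, (T x ω : ℂ) * (starRingEnd ℂ) (sphericalHarmonic l m x) ∂surfaceMeasure

/-- The angular power spectrum `C_ℓ = E|a_{ℓm}|²`. Under isotropy the right-hand side does not
depend on `m`; the definition takes the average over the `2ℓ+1` values of `m`. -/
def powerSpectrum [MeasurableSpace Ω] (T : S2 → Ω → ℝ) (P : Measure Ω) (l : ℕ) : ℝ :=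
  (∑ m ∈ Finset.Icc (-(l : ℤ)) l, ∫ ω, ‖harmonicCoeff T l m ω‖ ^ 2 ∂P) / (2 * l + 1)

/-- The Fourier component `T_ℓ(x) = ∑_{m=-ℓ}^{ℓ} a_{ℓm} Y_{ℓm}(x)`. The sum is a real number
(see `fourierComponent_eq`), and the real part only changes the type. -/
def fourierComponent (T : S2 → Ω → ℝ) (l : ℕ) (x : S2) (ω : Ω) : ℝ :=
  (∑ m ∈ Finset.Icc (-(l : ℤ)) l, harmonicCoeff T l m ω * sphericalHarmonic l m x).re

lemma sphericalHarmonic_neg (l : ℕ) (m : ℤ) (x : S2) :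
    sphericalHarmonic l (-m) x =
      (-1) ^ m.natAbs * (starRingEnd ℂ) (sphericalHarmonic l m x) := by
  have hs : ((-1 : ℂ) ^ m.natAbs) * (-1) ^ m.natAbs = 1 := by
    rw [← mul_pow]; simp
  rcases lt_trichotomy m 0 with h | h | h
  · simp only [sphericalHarmonic, Int.natAbs_neg, map_mul, Complex.conj_ofReal]
    rw [if_pos (by omega), if_neg (by omega)]
    simp only [map_pow, map_sub, map_mul, Complex.conj_ofReal, Complex.conj_I]
    ring
  · subst h
    simp [sphericalHarmonic]
  · simp only [sphericalHarmonic, Int.natAbs_neg, map_mul, Complex.conj_ofReal]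
    rw [if_neg (by omega), if_pos (by omega)]
    simp only [map_pow, map_add, map_mul, map_neg, map_one, Complex.conj_ofReal, Complex.conj_I]
    linear_combination (-(((Real.sqrt ((2 * l + 1) / (4 * Real.pi) *
      ((l - m.natAbs)! / (l + m.natAbs)!)) *
      (Polynomial.derivative^[m.natAbs] (legendre l)).eval (x.1 2) : ℝ) : ℂ)) *
      ((x.1 0 : ℂ) - Complex.I * (x.1 1 : ℂ)) ^ m.natAbs) * hs

lemma harmonicCoeff_neg (T : S2 → Ω → ℝ) (l : ℕ) (m : ℤ) (ω : Ω) :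
    harmonicCoeff T l (-m) ω =
      (-1) ^ m.natAbs * (starRingEnd ℂ) (harmonicCoeff T l m ω) := by
  unfold harmonicCoeff
  rw [← integral_conj, ← integral_const_mul]
  congr 1
  funext x
  rw [sphericalHarmonic_neg]
  simp only [map_mul, map_pow, map_neg, map_one, Complex.conj_ofReal, Complex.conj_conj]
  ring

/-- The sum that defines `T_ℓ(x)` is real. -/
lemma fourierComponent_eq (T : S2 → Ω → ℝ) (l : ℕ) (x : S2) (ω : Ω) :
    (fourierComponent T l x ω : ℂ) =
      ∑ m ∈ Finset.Icc (-(l : ℤ)) l, harmonicCoeff T l m ω * sphericalHarmonic l m x := by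
  unfold fourierComponent
  apply Complex.conj_eq_iff_re.mp
  rw [map_sum]
  refine Finset.sum_nbij' (fun m => -m) (fun m => -m) ?_ ?_ ?_ ?_ ?_
  · intro m hm; rw [Finset.mem_Icc] at hm ⊢; omega
  · intro m hm; rw [Finset.mem_Icc] at hm ⊢; omega
  · intro m _; simp
  · intro m _; simp
  · intro m _
    have hs : ((-1 : ℂ) ^ m.natAbs) * (-1) ^ m.natAbs = 1 := by
      rw [← mul_pow]; simp
    rw [sphericalHarmonic_neg, harmonicCoeff_neg, map_mul]
    linear_combination (-((starRingEnd ℂ) (harmonicCoeff T l m ω) *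
      (starRingEnd ℂ) (sphericalHarmonic l m x))) * hs

/-- The needlet (wavelet) field `β_j(x) = ∑_ℓ b(ℓ/B^j) T_ℓ(x)`; the sum is finite when `b`
vanishes outside `[B⁻¹, B]`. -/
def needletField (T : S2 → Ω → ℝ) (b : ℝ → ℝ) (B : ℝ) (j : ℕ) (x : S2) (ω : Ω) : ℝ :=
  ∑' l : ℕ, b (l / B ^ j) * fourierComponent T l x ω

/-- The normalized field `β̃_j(x) = β_j(x) / √(∑_ℓ b²(ℓ/B^j) (2ℓ+1)/(4π) C_ℓ)`. -/
def normalizedNeedletField [MeasurableSpace Ω] (T : S2 → Ω → ℝ) (P : Measure Ω)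
    (b : ℝ → ℝ) (B : ℝ) (j : ℕ) (x : S2) (ω : Ω) : ℝ :=
  needletField T b B j x ω /
    Real.sqrt (∑' l : ℕ, b (l / B ^ j) ^ 2 * ((2 * l + 1) / (4 * Real.pi)) * powerSpectrum T P l)

/-- The kernel `K(t) = ∑_{ℓ=0}^{L} (2ℓ+1)/(4π) κ(ℓ) P_ℓ(t)`. -/
def smoothingKernel (κ : ℕ → ℝ) (L : ℕ) (t : ℝ) : ℝ :=
  ∑ l ∈ Finset.range (L + 1), (2 * l + 1) / (4 * Real.pi) * κ l * (legendre l).eval t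

/-- The smoothed nonlinear transform
`g_{j;q}(x) = ∫_{S²} K(⟨x,y⟩) H_q(β̃_j(y)) dy`, with `H_q` the probabilists' Hermite polynomial. -/
def smoothedTransform [MeasurableSpace Ω] (T : S2 → Ω → ℝ) (P : Measure Ω)
    (b : ℝ → ℝ) (B : ℝ) (κ : ℕ → ℝ) (L : ℕ) (j q : ℕ) (x : S2) (ω : Ω) : ℝ :=
  ∫ y : S2, smoothingKernel κ L (inner ℝ x.1 y.1) *
    Polynomial.aeval (normalizedNeedletField T P b B j y ω) (Polynomial.hermite q) ∂surfaceMeasure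

end Fields

/-! ### Wigner's `3j` symbols -/

/-- `1/n!` for an integer `n ≥ 0`, and `0` for `n < 0`. -/
def invFactorial (n : ℤ) : ℝ := if 0 ≤ n then ((n.toNat ! : ℕ) : ℝ)⁻¹ else 0

/-- Wigner's `3j` symbol `(l₁ l₂ l₃; m₁ m₂ m₃)` for integer angular momenta, by Racah's formula.
It is `0` unless `|mᵢ| ≤ lᵢ`, `m₁ + m₂ + m₃ = 0` and the triangle inequalities hold; the sum
runs over all `z` such that no factorial has a negative argument. Under the side condition the
natural-number subtractions inside the factorials are exact. -/
def wigner3j (l₁ l₂ l₃ : ℕ) (m₁ m₂ m₃ : ℤ) : ℝ :=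
  if m₁ + m₂ + m₃ = 0 ∧ |m₁| ≤ l₁ ∧ |m₂| ≤ l₂ ∧ |m₃| ≤ l₃ ∧
      l₁ ≤ l₂ + l₃ ∧ l₂ ≤ l₁ + l₃ ∧ l₃ ≤ l₁ + l₂ then
    (-1 : ℝ) ^ ((l₁ : ℤ) - l₂ - m₃) *
    Real.sqrt (((l₁ + l₂ - l₃)! * (l₁ + l₃ - l₂)! * (l₂ + l₃ - l₁)! : ℕ) /
      ((l₁ + l₂ + l₃ + 1)! : ℕ)) *
    Real.sqrt ((((l₁ + m₁).toNat)! * ((l₁ - m₁).toNat)! * ((l₂ + m₂).toNat)! *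
      ((l₂ - m₂).toNat)! * ((l₃ + m₃).toNat)! * ((l₃ - m₃).toNat)! : ℕ) : ℝ) *
    ∑ z ∈ Finset.range (l₁ + l₂ + 1), (-1 : ℝ) ^ z *
      (invFactorial z * invFactorial (l₁ + l₂ - l₃ - z) * invFactorial (l₁ - m₁ - z) *
        invFactorial (l₂ + m₂ - z) * invFactorial (l₃ - l₂ + m₁ + z) *
        invFactorial (l₃ - l₁ - m₂ + z))
  else 0

end SphericalField

end

/-! Since `b` has compact support, the needlet field is band limited. By the addition theorem
`T_ℓ(y)` is the integral of `T` against the Legendre kernel `(2ℓ+1)/(4π) P_ℓ(⟨·,y⟩)`, so `β_j(y)` is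
almost surely the integral of `T` against a continuous kernel. Such integrals are jointly centred
Gaussian (`integral_cexp_fieldIntegral`, `identDistrib_fieldIntegral`): they lie in the closed
`L²`-span of the values of `T`. Unit variance makes the normalizing denominator equal to `1`.

Write `ρ(x,y) = ∑ b² C_ℓ (2ℓ+1)/(4π) P_ℓ(⟨x,y⟩)` for the covariance of `β_j`, where `C_ℓ` is
identified with the Funk-Hecke eigenvalue of the covariance of `T` (`powerSpectrum_eq`). Wick's
formula gives `E H₂(β_j(x)) H₂(β_j(y)) = 2ρ(x,y)²`, and Fubini turns the covariance of `g_{j;2}`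
into the composition of the kernels `K`, `2ρ²`, `K`. All three are rotation invariant, hence
diagonal in the Legendre kernels: by `funkHecke` and the reproducing property the composition is `∑
κ(ℓ)² μ_ℓ (2ℓ+1)/(4π) P_ℓ`, where `μ_ℓ` is the integral of `2ρ²` from the north pole against `P_ℓ`.
Expanding the square leaves integrals of triple products of Legendre polynomials over the sphere.

These integrals equal `4π` times the squared `3j` symbol. No representation theory enters. On one
side, at zero lower row Racah's sum is Dixon's alternating sum, so the squared symbol has a closed
form in central binomial coefficients (`wigner3j_sq`). On the other side, Bonnet's recursion and the
values on single Legendre polynomials determine any linear functional on triple products, and the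
closed form obeys the same recursion (`map_legendre_triple`).

For isotropy, `g_{j;2}` at finitely many points is a fixed measurable function of the finite vector
of harmonic coefficients of `T`. Rotating the points replaces the harmonics by rotated ones; the new
Gaussian vector has the same covariances, hence the same law. The addition theorem itself is proved
by showing that its left side is constant when both points rotate about the second axis. -/

noncomputable section

namespace SphericalField

set_option linter.unusedSectionVars false

/-! ### Legendre polynomials: recursions and differential equation from Rodrigues' formula. -/

section Legendre

open Polynomial

/-- `(X² - 1)^l / (2^l l!)`, whose `l`-th derivative is the Legendre polynomial. -/
def rodriguesBase (l : ℕ) : Polynomial ℝ := C ((2 ^ l * (l ! : ℝ))⁻¹) * (X ^ 2 - 1) ^ l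

lemma legendre_eq_iterate (l : ℕ) : legendre l = derivative^[l] (rodriguesBase l) := by
  rw [legendre, rodriguesBase, iterate_derivative_C_mul]

/-- The factor `1/(2^l l!)` is chosen so that no constant appears here. This relation and
`rodriguesBase_succ` are the source of all the recursions that follow. -/
lemma derivative_rodriguesBase_succ (l : ℕ) :
    derivative (rodriguesBase (l + 1)) = X * rodriguesBase l := by
  have h : ((2 ^ (l + 1) * ((l + 1)! : ℝ))⁻¹) * (2 * (l + 1)) = (2 ^ l * (l ! : ℝ))⁻¹ := by
    rw [Nat.factorial_succ]; push_cast
    have := Nat.factorial_pos l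
    rw [pow_succ]
    field_simp
  simp only [rodriguesBase]
  rw [derivative_C_mul, derivative_pow, ← h]
  simp only [map_mul, map_add, derivative_sub, derivative_X_pow, derivative_one,
    map_natCast, map_ofNat, map_one, Nat.add_sub_cancel]
  push_cast
  ring

lemma rodriguesBase_succ (l : ℕ) :
    (X ^ 2 - 1) * rodriguesBase l = 2 * ((l : ℝ[X]) + 1) * rodriguesBase (l + 1) := by
  have h : ((2 ^ (l + 1) * ((l + 1)! : ℝ))⁻¹) * (2 * (l + 1)) = (2 ^ l * (l ! : ℝ))⁻¹ := by
    rw [Nat.factorial_succ]; push_cast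
    have := Nat.factorial_pos l
    rw [pow_succ]
    field_simp
  simp only [rodriguesBase]
  rw [← h]
  have e : C (((2 ^ (l + 1) * ((l + 1)! : ℝ))⁻¹) * (2 * (l + 1))) =
      C ((2 ^ (l + 1) * ((l + 1)! : ℝ))⁻¹) * (2 * ((l : ℝ[X]) + 1)) := by
    simp only [map_mul, map_add, map_natCast, map_ofNat, map_one]
  rw [e]
  ring

lemma iterate_derivative_X_mul_succ (n : ℕ) (p : Polynomial ℝ) :
    derivative^[n + 1] (X * p) =
      X * derivative^[n + 1] p + ((n : ℝ[X]) + 1) * derivative^[n] p := by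
  induction n with
  | zero => simp [derivative_mul, add_comm]
  | succ n ih =>
    rw [Function.iterate_succ_apply', ih, derivative_add, derivative_mul,
      ← Function.iterate_succ_apply' (f := derivative) (n := n + 1)]
    have : ((n : Polynomial ℝ) + 1) = C ((n : ℝ) + 1) := by simp
    rw [this, derivative_C_mul, ← Function.iterate_succ_apply' (f := derivative) (n := n)]
    push_cast
    simp
    ring

lemma legendre_succ_succ_eq (l : ℕ) :
    legendre (l + 2) =
      X * legendre (l + 1) + ((l : ℝ[X]) + 1) * derivative^[l] (rodriguesBase (l + 1)) := by
  rw [legendre_eq_iterate, Function.iterate_succ_apply, derivative_rodriguesBase_succ,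
    iterate_derivative_X_mul_succ, legendre_eq_iterate]

lemma derivative_derivative_rodriguesBase (l : ℕ) :
    derivative (derivative (rodriguesBase (l + 2))) =
      (2 * l + 3 : ℕ) • rodriguesBase (l + 1) + rodriguesBase l := by
  rw [derivative_rodriguesBase_succ, derivative_mul, derivative_rodriguesBase_succ]
  have := rodriguesBase_succ l
  simp only [derivative_X, nsmul_eq_mul]
  push_cast
  linear_combination this

/-- A second relation containing the auxiliary term `D^l (rodriguesBase (l + 1))`; eliminating that
term against `legendre_succ_succ_eq` yields Bonnet's recursion. -/
lemma legendre_succ_succ_eq' (l : ℕ) :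
    legendre (l + 2) = (2 * l + 3 : ℕ) * derivative^[l] (rodriguesBase (l + 1)) + legendre l := by
  rw [legendre_eq_iterate, Function.iterate_succ_apply, Function.iterate_succ_apply,
    derivative_derivative_rodriguesBase, iterate_map_add, iterate_derivative_smul,
    ← legendre_eq_iterate, nsmul_eq_mul]

/-- Bonnet's recursion. -/
lemma legendre_bonnet (l : ℕ) :
    ((l : Polynomial ℝ) + 2) * legendre (l + 2) =
      (2 * (l : ℝ[X]) + 3) * X * legendre (l + 1) - ((l : ℝ[X]) + 1) * legendre l := by
  have h1 := legendre_succ_succ_eq l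
  have h2 := legendre_succ_succ_eq' l
  push_cast at h2
  linear_combination (2 * (l : Polynomial ℝ) + 3) * h1 - (l + 1) * h2

@[simp] lemma legendre_zero : legendre 0 = 1 := by simp [legendre]

@[simp] lemma legendre_one : legendre 1 = X := by
  rw [legendre_eq_iterate, Function.iterate_one, derivative_rodriguesBase_succ]
  simp [rodriguesBase]

lemma derivative_legendre_succ (l : ℕ) :
    derivative (legendre (l + 1)) = X * derivative (legendre l) + ((l : ℝ[X]) + 1) * legendre l := by
  rw [legendre_eq_iterate, ← Function.iterate_succ_apply' (f := derivative),
    Function.iterate_succ_apply, derivative_rodriguesBase_succ, iterate_derivative_X_mul_succ,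
    legendre_eq_iterate, ← Function.iterate_succ_apply' (f := derivative)]

lemma derivative_legendre_succ_succ (l : ℕ) :
    derivative (legendre (l + 2)) =
      (2 * (l : ℝ[X]) + 3) * legendre (l + 1) + derivative (legendre l) := by
  rw [legendre_succ_succ_eq', derivative_add, derivative_natCast_mul,
    ← Function.iterate_succ_apply' (f := derivative), ← legendre_eq_iterate]
  push_cast
  ring

/-- Obtained by eliminating `P'_l` and `P'_{l+2}` from the derivative recursions. One further
differentiation gives Legendre's equation. -/
lemma legendre_ode_first (l : ℕ) :
    (1 - X ^ 2) * derivative (legendre (l + 1)) =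
      ((l : ℝ[X]) + 1) * (legendre l - X * legendre (l + 1)) := by
  have h1 := derivative_legendre_succ l
  have h2 := derivative_legendre_succ (l + 1)
  have h3 := derivative_legendre_succ_succ l
  push_cast at h2
  linear_combination h1 + X * h2 - X * h3

/-- Legendre's differential equation. -/
lemma legendre_ode (l : ℕ) :
    (1 - X ^ 2) * derivative (derivative (legendre l)) - 2 * X * derivative (legendre l) +
      ((l : ℝ[X]) * ((l : ℝ[X]) + 1)) * legendre l = 0 := by
  cases l with
  | zero => simp
  | succ l =>
    have h1 := congrArg derivative (legendre_ode_first l)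
    have h2 := derivative_legendre_succ (l + 1)
    have h3 := derivative_legendre_succ_succ l
    have e : ((l : Polynomial ℝ) + 1) = ((l + 1 : ℕ) : Polynomial ℝ) := by push_cast; ring
    rw [e, derivative_natCast_mul] at h1
    simp only [derivative_mul, derivative_sub, derivative_X, derivative_one, derivative_X_pow] at h1
    push_cast at h1 h2 ⊢
    simp only [pow_one, zero_sub, map_ofNat] at h1
    linear_combination h1 + (l + 1) * (h2 - h3)

/-- The `m`-fold derivative of Legendre's differential equation. -/
lemma legendre_ode_iterate (l m : ℕ) :
    (1 - X ^ 2) * derivative^[m + 2] (legendre l) -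
      2 * ((m : ℝ[X]) + 1) * X * derivative^[m + 1] (legendre l) +
      ((l : ℝ[X]) * ((l : ℝ[X]) + 1) - (m : ℝ[X]) * ((m : ℝ[X]) + 1)) *
        derivative^[m] (legendre l) = 0 := by
  induction m with
  | zero => simpa using legendre_ode l
  | succ m ih =>
    have h1 := congrArg derivative ih
    have e : (2 * ((m : Polynomial ℝ) + 1)) = ((2 * (m + 1) : ℕ) : Polynomial ℝ) := by
      push_cast; ring
    have e' : ((l : Polynomial ℝ) * (l + 1) - m * (m + 1)) =
      C ((l : ℝ) * (l + 1) - m * (m + 1)) := by simp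
    rw [e, e', derivative_add, derivative_sub, mul_assoc, derivative_natCast_mul,
      derivative_C_mul, derivative_mul, derivative_mul] at h1
    simp only [← Function.iterate_succ_apply' (f := derivative)] at h1
    simp only [derivative_X, derivative_one, derivative_X_pow, map_zero,
      map_sub, map_mul, map_add, map_natCast, map_one] at h1
    push_cast at h1 ⊢
    simp only [pow_one, zero_sub, one_mul] at h1
    linear_combination h1

@[simp] lemma legendre_eval_one (l : ℕ) : (legendre l).eval 1 = 1 := by
  induction l using Nat.twoStepInduction with
  | zero => simp
  | one => simp
  | more l h1 h2 =>
    have := congrArg (eval 1) (legendre_bonnet l)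
    simp [h1, h2] at this
    have h : ((l : ℝ) + 2) ≠ 0 := by positivity
    apply mul_left_cancel₀ h
    linear_combination this

lemma natDegree_legendre_le (l : ℕ) : (legendre l).natDegree ≤ l := by
  rw [legendre_eq_iterate]
  refine (natDegree_iterate_derivative _ _).trans ?_
  have h1 : (X ^ 2 - 1 : ℝ[X]).natDegree ≤ 2 := by compute_degree
  have h2 : (rodriguesBase l).natDegree ≤ l * 2 := by
    refine (natDegree_C_mul_le _ _).trans (natDegree_pow_le.trans ?_)
    gcongr
  omega

lemma iterate_derivative_legendre_eq_zero {l m : ℕ} (h : l < m) :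
    derivative^[m] (legendre l) = 0 :=
  iterate_derivative_eq_zero ((natDegree_legendre_le l).trans_lt h)

end Legendre

section Wigner

open Polynomial

/-! ### Wigner's `3j` symbols with zero angular momentum components -/

/-- Valid for every integer because `1/n!` is taken to be `0` for negative `n`. Hence the
manipulations of factorial sums below need no boundary cases. -/
lemma mul_invFactorial (n : ℤ) : (n : ℝ) * invFactorial n = invFactorial (n - 1) := by
  rcases lt_trichotomy n 0 with h | h | h
  · rw [invFactorial, invFactorial, if_neg (by omega), if_neg (by omega), mul_zero]
  · subst h
    rw [invFactorial, invFactorial, if_neg (by omega : ¬ (0 : ℤ) ≤ 0 - 1)]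
    simp
  · obtain ⟨k, rfl⟩ : ∃ k : ℕ, n = (k + 1 : ℕ) := ⟨(n - 1).toNat, by omega⟩
    rw [invFactorial, invFactorial, if_pos (by omega), if_pos (by omega)]
    have h1 : (((k + 1 : ℕ) : ℤ) - 1).toNat = k := by omega
    rw [h1, Int.toNat_natCast, Nat.factorial_succ]
    push_cast
    have := Nat.factorial_pos k
    field_simp

lemma invFactorial_of_neg {n : ℤ} (h : n < 0) : invFactorial n = 0 := by
  rw [invFactorial, if_neg (by omega)]

lemma invFactorial_natCast (n : ℕ) : invFactorial n = ((n ! : ℕ) : ℝ)⁻¹ := by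
  rw [invFactorial, if_pos (by omega), Int.toNat_natCast]

/-- The summand of Dixon's identity, divided by `(a+b)! (b+c)! (c+a)!` and without the sign. -/
def dixonTerm (a b c k : ℤ) : ℝ :=
  invFactorial (a + k) * invFactorial (a - k) * (invFactorial (b + k) * invFactorial (b - k)) *
    (invFactorial (c + k) * invFactorial (c - k))

/-- The telescoping relation behind Dixon's identity. -/
lemma dixonTerm_telescope (a b c k : ℤ) :
    ((a : ℝ) + 1) * (a + b + 1) * (a + c + 1) * dixonTerm (a + 1) b c k -
        (a + b + c + 1) * dixonTerm a b c k =
      2⁻¹ * ((a + 1 + (k + 1)) * (b + (k + 1)) * (c + (k + 1)) * dixonTerm (a + 1) b c (k + 1)) +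
      2⁻¹ * ((a + 1 + k) * (b + k) * (c + k) * dixonTerm (a + 1) b c k) := by
  have e1 := mul_invFactorial (a + 1 + k)
  have e2 := mul_invFactorial (a + 1 - k)
  have f1 := mul_invFactorial (a + 1 + (k + 1))
  have f2 := mul_invFactorial (b + (k + 1))
  have f3 := mul_invFactorial (c + (k + 1))
  have g2 := mul_invFactorial (b - k)
  have g3 := mul_invFactorial (c - k)
  rw [show a + 1 + k - 1 = a + k by ring] at e1
  rw [show a + 1 - k - 1 = a - k by ring] at e2
  rw [show a + 1 + (k + 1) - 1 = a + 1 + k by ring] at f1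
  rw [show b + (k + 1) - 1 = b + k by ring] at f2
  rw [show c + (k + 1) - 1 = c + k by ring] at f3
  push_cast at e1 e2 f1 f2 f3 g2 g3
  -- Both sides are rewritten as polynomial multiples of the single quantity `dixonTerm (a + 1) b c
  -- k`; what remains is a polynomial identity.
  have h1 : dixonTerm a b c k = ((a + 1 + k) * (a + 1 - k)) * dixonTerm (a + 1) b c k := by
    unfold dixonTerm; rw [← e1, ← e2]; ring
  have h2 : ((a : ℝ) + 1 + (k + 1)) * (b + (k + 1)) * (c + (k + 1)) *
      dixonTerm (a + 1) b c (k + 1) =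
      (a + 1 - k) * (b - k) * (c - k) * dixonTerm (a + 1) b c k := by
    unfold dixonTerm
    rw [← f1, ← f2, ← f3, show a + 1 - (k + 1) = a + 1 - k - 1 by ring,
      show b - (k + 1) = b - k - 1 by ring, show c - (k + 1) = c - k - 1 by ring, ← g2, ← g3,
      show a + 1 - k - 1 = a - k by ring, ← e2]
    ring
  rw [h1, h2]
  ring

/-- Dixon's identity. -/
lemma dixon_identity (a b c M : ℕ) (hM : 2 * c < M) :
    ∑ z ∈ Finset.range M, (-1 : ℝ) ^ z * dixonTerm a b c ((z : ℤ) - c) =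
      (-1) ^ c * ((a + b + c)! / (a ! * b ! * c ! * (a + b)! * (b + c)! * (a + c)!)) := by
  induction a with
  | zero =>
    -- For `a = 0` only `k = 0` contributes, that is, `z = c`.
    rw [Finset.sum_eq_single c]
    · simp only [dixonTerm, sub_self, add_zero, sub_zero, invFactorial_natCast]
      have := Nat.factorial_pos b
      have := Nat.factorial_pos c
      have := Nat.factorial_pos (b + c)
      simp
      field_simp
    · intro z _ hz
      have : dixonTerm ((0 : ℕ) : ℤ) b c ((z : ℤ) - c) = 0 := by
        unfold dixonTerm
        rcases lt_or_gt_of_ne hz with h | h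
        · rw [invFactorial_of_neg (n := ((0 : ℕ) : ℤ) + _) (by omega)]; simp
        · rw [invFactorial_of_neg (n := ((0 : ℕ) : ℤ) - _) (by omega)]; simp
      rw [this, mul_zero]
    · intro h
      exact absurd (Finset.mem_range.mpr (by omega)) h
  | succ a ih =>
    -- The antidifference: the alternating sign turns the sum of two consecutive terms in
    -- `dixonTerm_telescope` into a difference.
    let G : ℕ → ℝ := fun z => -(2⁻¹ * ((-1) ^ z * (((a : ℝ) + 1 + ((z : ℝ) - c)) *
      (b + ((z : ℝ) - c)) * (c + ((z : ℝ) - c)) * dixonTerm (a + 1) b c ((z : ℤ) - c))))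
    have key : ∀ z ∈ Finset.range M,
        ((a : ℝ) + 1) * (a + b + 1) * (a + c + 1) *
          ((-1 : ℝ) ^ z * dixonTerm (a + 1) b c ((z : ℤ) - c)) -
        (a + b + c + 1) * ((-1 : ℝ) ^ z * dixonTerm a b c ((z : ℤ) - c)) = G (z + 1) - G z := by
      intro z _
      have h := dixonTerm_telescope a b c ((z : ℤ) - c)
      simp only [G]
      push_cast at h ⊢
      rw [show (z : ℤ) + 1 - c = z - c + 1 by ring, pow_succ]
      rw [show (z : ℝ) + 1 - c = z - c + 1 by ring]
      linear_combination (-1 : ℝ) ^ z * h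
    have hs := Finset.sum_congr rfl key
    rw [Finset.sum_range_sub, Finset.sum_sub_distrib, ← Finset.mul_sum, ← Finset.mul_sum, ih] at hs
    -- The boundary terms vanish: at `z = 0` by the factor `c + k` with `k = -c`, at `z = M` because
    -- `c - k = 2c - M` is negative.
    have hG0 : G 0 = 0 := by simp [G]
    have hGM : G M = 0 := by
      simp only [G, dixonTerm]
      rw [invFactorial_of_neg (n := (c : ℤ) - _) (by omega)]
      simp
    rw [hG0, hGM, sub_self, sub_eq_zero] at hs
    have h1 : ((a : ℝ) + 1) * (a + b + 1) * (a + c + 1) ≠ 0 := by positivity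
    apply mul_left_cancel₀ h1
    push_cast
    rw [hs, show a + 1 + b + c = (a + b + c) + 1 by ring, show a + 1 + b = (a + b) + 1 by ring,
      show a + 1 + c = (a + c) + 1 by ring]
    simp only [Nat.factorial_succ]
    push_cast
    have := Nat.factorial_pos a
    have := Nat.factorial_pos b
    have := Nat.factorial_pos c
    have := Nat.factorial_pos (a + b)
    have := Nat.factorial_pos (b + c)
    have := Nat.factorial_pos (a + c)
    field_simp

/-- The normalized central binomial coefficient `4^{-k} (2k choose k)`, extended by `0`. -/
def normalizedCentralBinom (k : ℤ) : ℝ :=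
  if 0 ≤ k then (Nat.centralBinom k.toNat : ℝ) / 4 ^ k.toNat else 0

/-- The extension by `0` respects the recursion also across `k = -1`, where the left factor `k + 1`
vanishes. -/
lemma normalizedCentralBinom_succ (k : ℤ) :
    ((k : ℝ) + 1) * normalizedCentralBinom (k + 1) = (k + 1 / 2) * normalizedCentralBinom k := by
  rcases lt_trichotomy k (-1) with h | h | h
  · rw [normalizedCentralBinom, normalizedCentralBinom, if_neg (by omega), if_neg (by omega)]
    simp
  · subst h
    simp [normalizedCentralBinom]
  · lift k to ℕ using by omega
    rw [normalizedCentralBinom, normalizedCentralBinom, if_pos (by omega), if_pos (by omega)]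
    rw [show ((k : ℤ) + 1).toNat = k + 1 by omega, Int.toNat_natCast]
    have := Nat.succ_mul_centralBinom_succ k
    have h' : ((k : ℝ) + 1) * (Nat.centralBinom (k + 1)) = 2 * (2 * k + 1) * Nat.centralBinom k := by
      exact_mod_cast this
    push_cast
    rw [pow_succ]
    field_simp
    linear_combination 2 * h'

lemma normalizedCentralBinom_pos {k : ℤ} (h : 0 ≤ k) : 0 < normalizedCentralBinom k := by
  rw [normalizedCentralBinom, if_pos h]
  have := Nat.centralBinom_pos k.toNat
  positivity

lemma normalizedCentralBinom_of_neg {k : ℤ} (h : k < 0) : normalizedCentralBinom k = 0 := by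
  rw [normalizedCentralBinom, if_neg (by omega)]

lemma normalizedCentralBinom_natCast (k : ℕ) :
    normalizedCentralBinom k = (2 * k)! / ((k ! : ℝ) ^ 2 * 4 ^ k) := by
  rw [normalizedCentralBinom, if_pos (by omega), Int.toNat_natCast]
  have h : (2 * k)! = Nat.centralBinom k * (k ! * k !) := by
    have := Nat.choose_mul_factorial_mul_factorial (n := 2 * k) (k := k) (by omega)
    rw [show 2 * k - k = k by omega] at this
    rw [Nat.centralBinom_eq_two_mul_choose, ← this]; ring
  rw [h]; push_cast
  have := Nat.factorial_pos k
  field_simp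

/-- The closed form of `∫ P_l P_m P_n / 2` in terms of `p = g - l`, `q = g - m`, `r = g - n`. -/
def adamsCoeff (p q r : ℤ) : ℝ :=
  normalizedCentralBinom p * normalizedCentralBinom q * normalizedCentralBinom r /
    ((2 * (p + q + r) + 1) * normalizedCentralBinom (p + q + r))

/-- This is `tripleCoeff_recursion` in the variables "half perimeter minus side". Negative arguments
are allowed, so the triangle inequalities need no separate treatment. -/
lemma adamsCoeff_recursion (p q r : ℤ) (hg : 1 ≤ p + q + r) :
    (2 * ((p : ℝ) + r) + 1) * (((q : ℝ) + r) * adamsCoeff p q r +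
        (q + r - 1) * adamsCoeff (p + 1) (q - 1) (r - 1)) =
      (2 * ((q : ℝ) + r) - 1) * (((p : ℝ) + r + 1) * adamsCoeff (p + 1) (q - 1) r +
        (p + r) * adamsCoeff p q (r - 1)) := by
  have ep := normalizedCentralBinom_succ p
  have eq := normalizedCentralBinom_succ (q - 1)
  have er := normalizedCentralBinom_succ (r - 1)
  have eg := normalizedCentralBinom_succ (p + q + r - 1)
  have hg1 := normalizedCentralBinom_pos (k := p + q + r) (by omega)
  simp only [sub_add_cancel] at eq er eg
  -- The denominators below are odd integers, hence nonzero whatever the signs of `p`, `q`, `r`; so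
  -- the recursion for central binomials can be solved in both directions.
  have np : (2 * (p : ℝ) + 1) ≠ 0 := by exact_mod_cast (by omega : 2 * p + 1 ≠ 0)
  have nq : (2 * (q : ℝ) - 1) ≠ 0 := by exact_mod_cast (by omega : 2 * q - 1 ≠ 0)
  have nr : (2 * (r : ℝ) - 1) ≠ 0 := by exact_mod_cast (by omega : 2 * r - 1 ≠ 0)
  have ng : (2 * ((p : ℝ) + q + r) - 1) ≠ 0 := by
    exact_mod_cast (by omega : 2 * (p + q + r) - 1 ≠ 0)
  have ng' : (2 * ((p : ℝ) + q + r) + 1) ≠ 0 := by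
    exact_mod_cast (by omega : 2 * (p + q + r) + 1 ≠ 0)
  have ng0 : ((p : ℝ) + q + r) ≠ 0 := by
    exact_mod_cast (by omega : (p + q + r) ≠ 0)
  push_cast at ep eq er eg
  have ap : normalizedCentralBinom p =
      2 * (p + 1) * normalizedCentralBinom (p + 1) / (2 * p + 1) := by
    field_simp; linear_combination -2 * ep
  have aq : normalizedCentralBinom (q - 1) = 2 * q * normalizedCentralBinom q / (2 * q - 1) := by
    field_simp; linear_combination -2 * eq
  have ar : normalizedCentralBinom (r - 1) = 2 * r * normalizedCentralBinom r / (2 * r - 1) := by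
    field_simp; linear_combination -2 * er
  have ag : normalizedCentralBinom (p + q + r - 1) =
      2 * (p + q + r) * normalizedCentralBinom (p + q + r) / (2 * (p + q + r) - 1) := by
    field_simp; linear_combination -2 * eg
  simp only [adamsCoeff]
  rw [show p + 1 + (q - 1) + (r - 1) = p + q + r - 1 by ring,
    show p + 1 + (q - 1) + r = p + q + r by ring, show p + q + (r - 1) = p + q + r - 1 by ring]
  push_cast
  rw [show 2 * ((p : ℝ) + 1 + (q - 1) + (r - 1)) + 1 = 2 * (p + q + r) - 1 by ring,
    show 2 * ((p : ℝ) + 1 + (q - 1) + r) + 1 = 2 * (p + q + r) + 1 by ring,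
    show 2 * ((p : ℝ) + q + (r - 1)) + 1 = 2 * (p + q + r) - 1 by ring]
  rw [ag, ap, aq, ar]
  generalize normalizedCentralBinom (p + 1) = a at *
  generalize normalizedCentralBinom q = b at *
  generalize normalizedCentralBinom r = c at *
  generalize normalizedCentralBinom (p + q + r) = d at *
  have hd : d ≠ 0 := hg1.ne'
  have e : (2 * ((p : ℝ) + q + r) - 1) * (2 * (p + q + r) * d / (2 * (p + q + r) - 1)) =
    2 * (p + q + r) * d := by field_simp
  rw [e]
  field_simp
  ring

/-- The closed form of `wigner3j l m n 0 0 0 ^ 2`. -/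
def tripleCoeff (l m n : ℕ) : ℝ :=
  if Even (l + m + n) then
    adamsCoeff (((l + m + n) / 2 : ℕ) - l) (((l + m + n) / 2 : ℕ) - m) (((l + m + n) / 2 : ℕ) - n)
  else 0

lemma tripleCoeff_zero (m n : ℕ) :
    tripleCoeff 0 m n = if m = n then 1 / (2 * (m : ℝ) + 1) else 0 := by
  unfold tripleCoeff
  by_cases h : m = n
  · subst h
    rw [if_pos (by simp), if_pos rfl, show (0 + m + m) / 2 = m by omega]
    have := normalizedCentralBinom_pos (k := (m : ℤ)) (by omega)
    have h0 : normalizedCentralBinom 0 = 1 := by simp [normalizedCentralBinom]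
    simp only [adamsCoeff, sub_self, h0]
    simp
    field_simp
  · rw [if_neg h]
    split_ifs with he
    · obtain ⟨g, hg⟩ := he
      rw [hg, show (g + g) / 2 = g by omega]
      unfold adamsCoeff
      rcases lt_or_gt_of_ne h with h | h
      · rw [normalizedCentralBinom_of_neg (k := (g : ℤ) - n) (by omega)]; simp
      · rw [normalizedCentralBinom_of_neg (k := (g : ℤ) - m) (by omega)]; simp
    · rfl

/-- The relation obtained for integrals of `P_l P_m P_n` by expanding `x P_l` or `x P_m` with
Bonnet's recursion in the integral of `x P_l P_m P_n`. -/
lemma tripleCoeff_recursion (l m n : ℕ) :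
    (2 * (m : ℝ) + 1) * ((l + 1) * tripleCoeff (l + 1) m n + l * tripleCoeff (l - 1) m n) =
      (2 * (l : ℝ) + 1) * ((m + 1) * tripleCoeff l (m + 1) n + m * tripleCoeff l (m - 1) n) := by
  by_cases he : Even (l + 1 + m + n)
  · obtain ⟨g, hg⟩ := he
    have e1 : tripleCoeff (l + 1) m n = adamsCoeff (g - (l + 1)) (g - m) (g - n) := by
      rw [tripleCoeff, if_pos ⟨g, hg⟩, hg, show (g + g) / 2 = g by omega]; push_cast; rfl
    have e2 : tripleCoeff l (m + 1) n = adamsCoeff (g - l) (g - m - 1) (g - n) := by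
      rw [tripleCoeff, if_pos ⟨g, by omega⟩, show (l + (m + 1) + n) / 2 = g by omega]
      push_cast; rw [sub_sub (g : ℤ) m 1]
    -- The factor `l` is kept because the truncated `l - 1` is wrong at `l = 0`, where the factor
    -- vanishes.
    have e3 : (l : ℝ) * tripleCoeff (l - 1) m n =
        l * adamsCoeff (g - l) (g - m - 1) (g - n - 1) := by
      rcases Nat.eq_zero_or_pos l with h | h
      · simp [h]
      · rw [tripleCoeff, if_pos ⟨g - 1, by omega⟩, show (l - 1 + m + n) / 2 = g - 1 by omega]
        congr 2
        · omega
        · omega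
        · omega
    have e4 : (m : ℝ) * tripleCoeff l (m - 1) n =
        m * adamsCoeff (g - (l + 1)) (g - m) (g - n - 1) := by
      rcases Nat.eq_zero_or_pos m with h | h
      · simp [h]
      · rw [tripleCoeff, if_pos ⟨g - 1, by omega⟩, show (l + (m - 1) + n) / 2 = g - 1 by omega]
        congr 2
        · omega
        · omega
        · omega
    rw [e1, e2, e3, e4]
    have h := adamsCoeff_recursion (g - (l + 1)) (g - m) (g - n) (by omega)
    rw [show (g : ℤ) - (l + 1) + 1 = g - l by ring] at h
    push_cast at h
    have hg' : (l : ℝ) + 1 + m + n = g + g := by exact_mod_cast hg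
    have h1 : (g : ℝ) - (l + 1) + (g - n) = m := by linarith
    have h2 : (g : ℝ) - m + (g - n) = l + 1 := by linarith
    rw [h1, h2] at h
    linear_combination h
  · have h1 : tripleCoeff (l + 1) m n = 0 := by rw [tripleCoeff, if_neg he]
    have h2 : tripleCoeff l (m + 1) n = 0 := by
      rw [tripleCoeff, if_neg]; intro h; apply he; convert h using 1; ring
    have h3 : (l : ℝ) * tripleCoeff (l - 1) m n = 0 := by
      rcases Nat.eq_zero_or_pos l with h | h
      · simp [h]
      · rw [tripleCoeff, if_neg, mul_zero]
        rintro ⟨g, hg⟩; exact he ⟨g + 1, by omega⟩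
    have h4 : (m : ℝ) * tripleCoeff l (m - 1) n = 0 := by
      rcases Nat.eq_zero_or_pos m with h | h
      · simp [h]
      · rw [tripleCoeff, if_neg, mul_zero]
        rintro ⟨g, hg⟩; exact he ⟨g + 1, by omega⟩
    rw [h1, h2, h3, h4]
    simp

/-! ### Racah's sum at zero lower row. -/

lemma wigner3j_zero_eq (l m n : ℕ) (h : l ≤ m + n ∧ m ≤ l + n ∧ n ≤ l + m) :
    wigner3j l m n 0 0 0 = (-1 : ℝ) ^ ((l : ℤ) - m) *
      Real.sqrt (((l + m - n)! * (l + n - m)! * (m + n - l)! : ℕ) / ((l + m + n + 1)! : ℕ)) *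
      (l ! * m ! * n !) *
      ∑ z ∈ Finset.range (l + m + 1), (-1 : ℝ) ^ z *
      (invFactorial z * invFactorial (l + m - n - z) * invFactorial (l - z) *
        invFactorial (m - z) * invFactorial (n - m + z) * invFactorial (n - l + z)) := by
  rw [wigner3j, if_pos (by simp; omega)]
  simp only [sub_zero, add_zero, Int.toNat_natCast]
  congr 2
  rw [show ((l ! * l ! * m ! * m ! * n ! * n ! : ℕ) : ℝ) = ((l ! * m ! * n ! : ℕ) : ℝ) ^ 2 by
    push_cast; ring, Real.sqrt_sq (by positivity)]
  push_cast; ring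

/-- The reflection `z ↦ s - z` with `s = l + m - n` permutes the six factorials and multiplies the
sign by `(-1)^s = -1`. -/
lemma racah_sum_eq_zero_of_odd (l m n : ℕ) (h : n ≤ l + m) (ho : ¬ Even (l + m + n)) :
    ∑ z ∈ Finset.range (l + m + 1), (-1 : ℝ) ^ z *
      (invFactorial z * invFactorial (l + m - n - z) * invFactorial (l - z) *
        invFactorial (m - z) * invFactorial (n - m + z) * invFactorial (n - l + z)) = 0 := by
  obtain ⟨s, hs⟩ := Nat.exists_eq_add_of_le h
  rw [← Finset.sum_subset (Finset.range_subset_range.mpr (by omega : s + 1 ≤ l + m + 1))]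
  · set t : ℕ → ℝ := fun z => (-1 : ℝ) ^ z *
      (invFactorial z * invFactorial (l + m - n - z) * invFactorial (l - z) *
        invFactorial (m - z) * invFactorial (n - m + z) * invFactorial (n - l + z)) with ht
    have h1 : ∀ z ∈ Finset.range (s + 1), t (s + 1 - 1 - z) = - t z := by
      intro z hz
      rw [Finset.mem_range] at hz
      obtain ⟨y, rfl⟩ : ∃ y, s = z + y := ⟨s - z, by omega⟩
      rw [show z + y + 1 - 1 - z = y by omega]
      have hsign : (-1 : ℝ) ^ y = - (-1) ^ z := by
        have hodd : Odd (z + y) := by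
          rw [Nat.not_even_iff_odd] at ho
          rw [hs] at ho
          rcases ho with ⟨k, hk⟩
          exact ⟨k - n, by omega⟩
        have := hodd.neg_one_pow (α := ℝ)
        rw [pow_add] at this
        have h2 : ((-1 : ℝ) ^ z) * (-1) ^ z = 1 := by rw [← mul_pow]; simp
        linear_combination (-1 : ℝ) ^ z * this - (-1) ^ y * h2
      simp only [ht]
      rw [hsign, show ((l : ℤ) + m - n - y) = z by omega, show ((l : ℤ) + m - n - z) = y by omega,
        show (n : ℤ) - m + y = l - z by omega, show (n : ℤ) - l + y = m - z by omega,
        show (n : ℤ) - m + z = l - y by omega, show (n : ℤ) - l + z = m - y by omega]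
      ring
    have h2 := Finset.sum_range_reflect t (s + 1)
    rw [Finset.sum_congr rfl h1, Finset.sum_neg_distrib] at h2
    linarith
  · intro z _ hz
    rw [Finset.mem_range] at hz
    rw [invFactorial_of_neg (n := (l : ℤ) + m - n - z) (by omega)]
    simp

/-- Put `l = b + c`, `m = a + c`, `n = a + b`. Racah's sum is then Dixon's sum shifted by `c`, and
squaring removes the phase and the square root. Outside the triangle one of `g - l`, `g - m`, `g -
n` is negative, so the closed form is `0` as well. -/
lemma wigner3j_sq (l m n : ℕ) : wigner3j l m n 0 0 0 ^ 2 = tripleCoeff l m n := by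
  by_cases htri : l ≤ m + n ∧ m ≤ l + n ∧ n ≤ l + m
  · rw [wigner3j_zero_eq l m n htri]
    by_cases he : Even (l + m + n)
    · obtain ⟨g, hg⟩ := he
      obtain ⟨a, ha⟩ := Nat.exists_eq_add_of_le (by omega : l ≤ g)
      obtain ⟨b, hb⟩ := Nat.exists_eq_add_of_le (by omega : m ≤ g)
      obtain ⟨c, hc⟩ := Nat.exists_eq_add_of_le (by omega : n ≤ g)
      obtain rfl : g = a + b + c := by omega
      obtain rfl : l = b + c := by omega
      obtain rfl : m = a + c := by omega
      obtain rfl : n = a + b := by omega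
      have hd := dixon_identity a b c (b + c + (a + c) + 1) (by omega)
      rw [Finset.sum_congr rfl (g := fun z : ℕ => (-1 : ℝ) ^ z * dixonTerm a b c ((z : ℤ) - c)), hd]
      · rw [tripleCoeff, if_pos ⟨_, hg⟩, hg,
          show (a + b + c + (a + b + c)) / 2 = a + b + c by omega]
        rw [show (((a + b + c : ℕ) : ℤ) - ((b + c : ℕ) : ℤ)) = a by push_cast; ring,
          show (((a + b + c : ℕ) : ℤ) - ((a + c : ℕ) : ℤ)) = b by push_cast; ring,
          show (((a + b + c : ℕ) : ℤ) - ((a + b : ℕ) : ℤ)) = c by push_cast; ring]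
        rw [adamsCoeff, show (a : ℤ) + b + c = (a + b + c : ℕ) by push_cast; ring]
        simp only [normalizedCentralBinom_natCast]
        rw [show b + c + (a + c) - (a + b) = 2 * c by omega,
          show b + c + (a + b) - (a + c) = 2 * b by omega,
          show a + c + (a + b) - (b + c) = 2 * a by omega,
          show a + b + c + (a + b + c) + 1 = 2 * (a + b + c) + 1 by ring]
        rw [mul_pow, mul_pow, mul_pow, Real.sq_sqrt (by positivity), mul_pow, mul_pow ((-1) ^ c)]
        have s1 : ((-1 : ℝ) ^ (((b + c : ℕ) : ℤ) - ((a + c : ℕ) : ℤ))) ^ 2 = 1 := by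
          rw [← zpow_natCast, ← zpow_mul, mul_comm, zpow_mul]; simp
        have s2 : ((-1 : ℝ) ^ c) ^ 2 = 1 := by rw [← pow_mul, mul_comm, pow_mul]; simp
        rw [s1, s2, Nat.factorial_succ]
        have := Nat.factorial_pos a
        have := Nat.factorial_pos b
        have := Nat.factorial_pos c
        have := Nat.factorial_pos (a + b)
        have := Nat.factorial_pos (b + c)
        have := Nat.factorial_pos (a + c)
        have := Nat.factorial_pos (a + b + c)
        have := Nat.factorial_pos (2 * (a + b + c))
        push_cast
        rw [pow_add, pow_add]
        field_simp
      · intro z _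
        congr 1
        unfold dixonTerm
        push_cast
        rw [show (b : ℤ) + c + (a + c) - (a + b) - z = c - (z - c) by ring,
          show (b : ℤ) + c - z = b - (z - c) by ring,
          show (a : ℤ) + c - z = a - (z - c) by ring,
          show (a : ℤ) + b - (a + c) + z = b + (z - c) by ring,
          show (a : ℤ) + b - (b + c) + z = a + (z - c) by ring,
          show (c : ℤ) + (z - c) = z by ring]
        ring
    · rw [racah_sum_eq_zero_of_odd l m n htri.2.2 he, tripleCoeff, if_neg he]
      simp
  · rw [wigner3j, if_neg (by simp; omega), tripleCoeff]
    split_ifs with he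
    · obtain ⟨g, hg⟩ := he
      rw [hg, show (g + g) / 2 = g by omega, adamsCoeff]
      by_cases h1 : g < l
      · rw [normalizedCentralBinom_of_neg (k := (g : ℤ) - l) (by omega)]; simp
      by_cases h2 : g < m
      · rw [normalizedCentralBinom_of_neg (k := (g : ℤ) - m) (by omega)]; simp
      · rw [normalizedCentralBinom_of_neg (k := (g : ℤ) - n) (by omega)]; simp
    · simp

/-! ### Integrals of products of Legendre polynomials -/

lemma X_mul_legendre (n : ℕ) :
    (2 * (n : ℝ) + 1) • (X * legendre n) =
      ((n : ℝ) + 1) • legendre (n + 1) + (n : ℝ) • legendre (n - 1) := by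
  cases n with
  | zero => simp
  | succ n =>
    have h := legendre_bonnet n
    simp only [smul_eq_C_mul, Nat.add_sub_cancel]
    push_cast
    simp only [map_mul, map_add, map_natCast, map_ofNat, map_one]
    linear_combination -h

/-- The recursion gives row `l + 1` from rows `l` and `l - 1`, since `(2m + 1)(l + 1) ≠ 0`; at `l =
0` the row `l - 1` has coefficient `0`, so row `0` determines everything. -/
lemma eq_of_bonnet_recursion {F G : ℕ → ℕ → ℝ}
    (hF : ∀ l m : ℕ, (2 * (m : ℝ) + 1) * ((l + 1) * F (l + 1) m + l * F (l - 1) m) =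
      (2 * (l : ℝ) + 1) * ((m + 1) * F l (m + 1) + m * F l (m - 1)))
    (hG : ∀ l m : ℕ, (2 * (m : ℝ) + 1) * ((l + 1) * G (l + 1) m + l * G (l - 1) m) =
      (2 * (l : ℝ) + 1) * ((m + 1) * G l (m + 1) + m * G l (m - 1)))
    (h0 : ∀ m, F 0 m = G 0 m) (l m : ℕ) : F l m = G l m := by
  have step : ∀ l : ℕ, (∀ m, F l m = G l m) → (∀ m, (l : ℝ) * F (l - 1) m = l * G (l - 1) m) →
      ∀ m, F (l + 1) m = G (l + 1) m := by
    intro l h1 h2 m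
    have a := hF l m
    have b := hG l m
    rw [h1, h1, h2] at a
    have c : ((2 * (m : ℝ) + 1) * (l + 1)) ≠ 0 := by positivity
    apply mul_left_cancel₀ c
    linear_combination a - b
  induction l using Nat.twoStepInduction generalizing m with
  | zero => exact h0 m
  | one => exact step 0 h0 (by simp) m
  | more l h1 h2 => exact step (l + 1) h2 (by simp [h1]) m

/-- If a linear functional annihilates all Legendre polynomials but the first, then on triple
products of Legendre polynomials it is given by Wigner's `3j` symbols. -/
lemma map_legendre_triple (Λ : ℝ[X] →ₗ[ℝ] ℝ) (h0 : Λ (legendre 0) = 1)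
    (h1 : ∀ n, n ≠ 0 → Λ (legendre n) = 0) (l m n : ℕ) :
    Λ (legendre l * legendre m * legendre n) = wigner3j l m n 0 0 0 ^ 2 := by
  have hrec : ∀ (q : ℝ[X]) (l m : ℕ), (2 * (m : ℝ) + 1) *
      ((l + 1) * Λ (legendre (l + 1) * legendre m * q) + l * Λ (legendre (l - 1) * legendre m * q)) =
      (2 * (l : ℝ) + 1) * ((m + 1) * Λ (legendre l * legendre (m + 1) * q) +
        m * Λ (legendre l * legendre (m - 1) * q)) := by
    intro q l m
    have a := X_mul_legendre l
    have b := X_mul_legendre m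
    have e1 := congrArg (fun p => Λ (p * (legendre m * q))) a
    have e2 := congrArg (fun p => Λ (p * (legendre l * q))) b
    simp only [add_mul, smul_mul_assoc, map_add, map_smul, smul_eq_mul] at e1 e2
    rw [show X * legendre m * (legendre l * q) = X * legendre l * (legendre m * q) by ring,
      show legendre (m + 1) * (legendre l * q) = legendre l * legendre (m + 1) * q by ring,
      show legendre (m - 1) * (legendre l * q) = legendre l * legendre (m - 1) * q by ring] at e2
    simp only [← mul_assoc (legendre _) (legendre _) q] at e1 e2
    linear_combination -(2 * (m : ℝ) + 1) * e1 + (2 * (l : ℝ) + 1) * e2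
  -- The same uniqueness is used twice: first with the third factor `1`, starting from the
  -- prescribed values on single Legendre polynomials, then with third factor `P_n`, whose row `0`
  -- is the result for double products.
  have two : ∀ m n, Λ (legendre m * legendre n) = if m = n then 1 / (2 * (m : ℝ) + 1) else 0 := by
    intro m n
    have h := eq_of_bonnet_recursion (F := fun l m => Λ (legendre l * legendre m * 1))
      (G := fun l m => tripleCoeff l m 0) (hrec 1) (fun l m => tripleCoeff_recursion l m 0) (by
        intro m
        rw [tripleCoeff_zero]
        split_ifs with h
        · subst h; simpa using h0
        · simpa using h1 m h) m n
    simp only [mul_one] at h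
    rw [h]
    rw [← tripleCoeff_zero, tripleCoeff, tripleCoeff, show m + n + 0 = 0 + m + n by ring]
    split_ifs
    · simp only [adamsCoeff]
      rw [show ∀ a b c : ℤ, a + b + c = c + a + b by intros; ring,
        show ∀ a b c : ℝ, a + b + c = c + a + b by intros; ring]
      ring
    · rfl
  rw [wigner3j_sq]
  refine eq_of_bonnet_recursion (F := fun l m => Λ (legendre l * legendre m * legendre n))
      (G := fun l m => tripleCoeff l m n) (hrec _) (fun l m => tripleCoeff_recursion l m n) ?_ l m
  intro m
  simp only [tripleCoeff_zero, legendre_zero, one_mul, two]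

lemma wigner3j_zero_left_sq (m n : ℕ) :
    wigner3j 0 m n 0 0 0 ^ 2 = if m = n then 1 / (2 * (m : ℝ) + 1) else 0 := by
  rw [wigner3j_sq, tripleCoeff_zero]

end Wigner

section Addition

open Polynomial

/-! ### The addition theorem -/

/-- The unnormalized solid harmonic `P_l^{(m)}(z) ξ^m`, where `ξ = x + i y`. -/
def solidHarmonic (l m : ℕ) (ξ : ℂ) (z : ℝ) : ℂ :=
  (((derivative^[m] (legendre l)).eval z : ℝ) : ℂ) * ξ ^ m

/-- The normalization factor `(l - m)! / (l + m)!`. -/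
def factorialRatio (l m : ℕ) : ℝ := ((l - m)! : ℝ) / ((l + m)! : ℝ)

lemma factorialRatio_succ {l m : ℕ} (h : m < l) :
    factorialRatio l (m + 1) * (((l : ℝ) + m + 1) * (l - m)) = factorialRatio l m := by
  obtain ⟨k, rfl⟩ := Nat.exists_eq_add_of_lt h
  unfold factorialRatio
  rw [show m + k + 1 - (m + 1) = k by omega, show m + k + 1 - m = k + 1 by omega,
    show m + k + 1 + (m + 1) = (m + k + 1 + m) + 1 by ring, Nat.factorial_succ k,
    Nat.factorial_succ (m + k + 1 + m)]
  have := Nat.factorial_pos (m + k + 1 + m)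
  push_cast
  field_simp
  ring

/-- The sum over `m` in the addition theorem, up to the factor `(2l+1)/(4π)`. -/
def zonalSum (l : ℕ) (ξ : ℂ) (z : ℝ) (η : ℂ) (w : ℝ) : ℝ :=
  (legendre l).eval z * (legendre l).eval w + 2 * ∑ m ∈ Finset.range l,
    factorialRatio l (m + 1) *
      (solidHarmonic l (m + 1) ξ z * (starRingEnd ℂ) (solidHarmonic l (m + 1) η w)).re

/-- Invariance under simultaneous rotation about the third axis: the phases `u^m` and `conj u^m`
cancel. -/
lemma zonalSum_mul_unit (l : ℕ) (u ξ : ℂ) (z : ℝ) (η : ℂ) (w : ℝ)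
    (hu : u * (starRingEnd ℂ) u = 1) :
    zonalSum l (u * ξ) z (u * η) w = zonalSum l ξ z η w := by
  unfold zonalSum
  congr 2
  refine Finset.sum_congr rfl fun m _ => ?_
  congr 2
  simp only [solidHarmonic, map_mul, map_pow, Complex.conj_ofReal, mul_pow]
  have h : u ^ (m + 1) * (starRingEnd ℂ) u ^ (m + 1) = 1 := by rw [← mul_pow, hu, one_pow]
  linear_combination ((((derivative^[m + 1] (legendre l)).eval z : ℝ) : ℂ) * ξ ^ (m + 1) *
    ((((derivative^[m + 1] (legendre l)).eval w : ℝ) : ℂ) * (starRingEnd ℂ) η ^ (m + 1))) * h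

lemma zonalSum_pole (l : ℕ) (η : ℂ) (w : ℝ) : zonalSum l 0 1 η w = (legendre l).eval w := by
  simp [zonalSum, solidHarmonic]

/-- The curves of the rotation about the second axis, in the coordinates `ξ = x + i y`, `z`. -/
structure IsRotationCurve (ξ : ℝ → ℂ) (z : ℝ → ℝ) : Prop where
  hasDerivAt_xi : ∀ t, HasDerivAt ξ (z t : ℂ) t
  hasDerivAt_z : ∀ t, HasDerivAt z (-(ξ t).re) t
  normSq_add : ∀ t, Complex.normSq (ξ t) + z t ^ 2 = 1

lemma IsRotationCurve.hasDerivAt_legendre {ξ : ℝ → ℂ} {z : ℝ → ℝ} (h : IsRotationCurve ξ z)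
    (p : ℝ[X]) (t : ℝ) :
    HasDerivAt (fun t => p.eval (z t)) (-(ξ t).re * (derivative p).eval (z t)) t := by
  have := (p.hasDerivAt (z t)).comp t (h.hasDerivAt_z t)
  rw [mul_comm]
  exact this

/-- A ladder relation: an infinitesimal rotation about the second axis couples the order only to its
two neighbours. The coefficient of the lower one comes from the differentiated Legendre equation
together with `|ξ|² = 1 - z²`. -/
lemma IsRotationCurve.hasDerivAt_solidHarmonic {ξ : ℝ → ℂ} {z : ℝ → ℝ} (h : IsRotationCurve ξ z)
    (l m : ℕ) (t : ℝ) :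
    HasDerivAt (fun t => solidHarmonic l (m + 1) (ξ t) (z t))
      (2⁻¹ * ((((l : ℝ) + m + 1) * (l - m) : ℝ) * solidHarmonic l m (ξ t) (z t) -
        solidHarmonic l (m + 2) (ξ t) (z t))) t := by
  have h1 := (h.hasDerivAt_legendre (derivative^[m + 1] (legendre l)) t).ofReal_comp
  have h2 := (h.hasDerivAt_xi t).pow (m + 1)
  refine (h1.mul h2).congr_deriv ?_
  have ode := congrArg (fun p => ((p.eval (z t) : ℝ) : ℂ)) (legendre_ode_iterate l m)
  have hn : ξ t * (starRingEnd ℂ) (ξ t) = 1 - (z t : ℂ) ^ 2 := by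
    rw [Complex.mul_conj, eq_sub_iff_add_eq.mpr (h.normSq_add t)]
    push_cast; ring
  have hre : ((ξ t).re : ℂ) = (ξ t + (starRingEnd ℂ) (ξ t)) / 2 := by
    rw [Complex.add_conj]; push_cast; ring
  simp only [solidHarmonic, ← Function.iterate_succ_apply' (f := derivative)]
  simp only [eval_add, eval_sub, eval_mul, eval_pow, eval_X, eval_one, eval_natCast, eval_zero,
    eval_ofNat] at ode
  push_cast at ode ⊢
  rw [hre]
  simp only [Nat.succ_eq_add_one, Pi.pow_apply, add_assoc, Nat.reduceAdd]
  linear_combination (-2⁻¹ * ξ t ^ m) * ode +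
    (-2⁻¹ * ξ t ^ m * (((derivative^[m + 2] (legendre l)).eval (z t) : ℝ) : ℂ)) * hn

/-- By the ladder relation the derivatives of the terms telescope in `m`, the weights
`(l-m)!/(l+m)!` absorbing the ladder coefficients. The upper end vanishes because `P_l` has degree
at most `l`, and the lower end cancels the derivative of the `m = 0` term. -/
lemma zonalSum_rotationCurve (l : ℕ) {ξ η : ℝ → ℂ} {z w : ℝ → ℝ} (h : IsRotationCurve ξ z)
    (h' : IsRotationCurve η w) (s t : ℝ) :
    zonalSum l (ξ s) (z s) (η s) (w s) = zonalSum l (ξ t) (z t) (η t) (w t) := by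
  have key : ∀ t, HasDerivAt (fun t => zonalSum l (ξ t) (z t) (η t) (w t)) 0 t := by
    intro t
    let c : ℕ → ℂ := fun m => factorialRatio l m *
      (solidHarmonic l m (ξ t) (z t) * (starRingEnd ℂ) (solidHarmonic l (m + 1) (η t) (w t)) +
       solidHarmonic l (m + 1) (ξ t) (z t) * (starRingEnd ℂ) (solidHarmonic l m (η t) (w t)))
    have hterm : ∀ m ∈ Finset.range l, HasDerivAt (fun t => factorialRatio l (m + 1) *
        (solidHarmonic l (m + 1) (ξ t) (z t) *
          (starRingEnd ℂ) (solidHarmonic l (m + 1) (η t) (w t))).re)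
        (2⁻¹ * ((c m).re - (c (m + 1)).re)) t := by
      intro m hm
      have hm := factorialRatio_succ (Finset.mem_range.mp hm)
      have a := h.hasDerivAt_solidHarmonic l m t
      have b := (h'.hasDerivAt_solidHarmonic l m t).star
      have d := (Complex.reCLM.hasFDerivAt.comp_hasDerivAt t (a.mul b)).const_mul
        (factorialRatio l (m + 1))
      refine d.congr_deriv ?_
      rw [← Complex.sub_re]
      have e : ∀ (r : ℝ) (v : ℂ), r * v.re = ((r : ℂ) * v).re := by intros; simp
      rw [Complex.reCLM_apply, e, show (2⁻¹ : ℝ) = ((2⁻¹ : ℝ)) from rfl, e]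
      congr 1
      simp only [c]
      rw [← hm]
      simp only [Complex.star_def, map_mul, map_sub, map_inv₀, map_ofNat, Complex.conj_ofReal]
      push_cast
      ring
    have hsum := HasDerivAt.fun_sum hterm
    rw [← Finset.mul_sum, Finset.sum_range_sub'] at hsum
    have hl : c l = 0 := by
      have h := iterate_derivative_legendre_eq_zero (Nat.lt_succ_self l)
      simp only [c, solidHarmonic, h]
      simp
    have h0 : (c 0).re = (legendre l).eval (z t) * ((η t).re * (derivative (legendre l)).eval (w t))
        + (ξ t).re * (derivative (legendre l)).eval (z t) * (legendre l).eval (w t) := by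
      have : factorialRatio l 0 = 1 := by
        rw [factorialRatio]; simp [Nat.factorial_ne_zero]
      simp [c, solidHarmonic, this]
      ring
    have hfirst := (h.hasDerivAt_legendre (legendre l) t).mul (h'.hasDerivAt_legendre (legendre l) t)
    refine (hfirst.add (hsum.const_mul 2)).congr_deriv ?_
    rw [hl, h0, Complex.zero_re]
    ring
  exact is_const_of_deriv_eq_zero (fun t => (key t).differentiableAt) (fun t => (key t).deriv) s t

lemma isRotationCurve (ξ : ℂ) (z : ℝ) (h : Complex.normSq ξ + z ^ 2 = 1) :
    IsRotationCurve (fun t => ((ξ.re * Real.cos t + z * Real.sin t : ℝ) : ℂ) + Complex.I * ξ.im)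
      (fun t => -(ξ.re * Real.sin t) + z * Real.cos t) where
  hasDerivAt_xi t := by
    have h1 : HasDerivAt (fun t => ξ.re * Real.cos t + z * Real.sin t)
      (ξ.re * (-Real.sin t) + z * Real.cos t) t :=
      ((Real.hasDerivAt_cos t).const_mul _).add ((Real.hasDerivAt_sin t).const_mul _)
    refine (h1.ofReal_comp.add_const (Complex.I * ξ.im)).congr_deriv ?_
    push_cast; ring
  hasDerivAt_z t := by
    have h1 : HasDerivAt (fun t => -(ξ.re * Real.sin t) + z * Real.cos t)
      (-(ξ.re * Real.cos t) + z * (-Real.sin t)) t :=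
      ((Real.hasDerivAt_sin t).const_mul _).neg.add ((Real.hasDerivAt_cos t).const_mul _)
    refine h1.congr_deriv ?_
    simp only [Complex.add_re, Complex.ofReal_re, Complex.mul_re, Complex.I_re, Complex.I_im,
      Complex.ofReal_im]
    ring
  normSq_add t := by
    rw [Complex.normSq_apply] at h ⊢
    simp only [Complex.add_re, Complex.ofReal_re, Complex.mul_re, Complex.I_re, Complex.I_im,
      Complex.ofReal_im, Complex.add_im, Complex.mul_im]
    linear_combination h + (ξ.re ^ 2 + z ^ 2) * Real.sin_sq_add_cos_sq t

/-- A rotation about the third axis makes `ξ` real and one about the second axis takes the first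
point to the pole. There only `m = 0` survives, and the height of the second point has become the
scalar product. -/
lemma zonalSum_eq (l : ℕ) (ξ η : ℂ) (z w : ℝ) (h : Complex.normSq ξ + z ^ 2 = 1)
    (h' : Complex.normSq η + w ^ 2 = 1) :
    zonalSum l ξ z η w = (legendre l).eval (ξ.re * η.re + ξ.im * η.im + z * w) := by
  obtain ⟨u, hu, hξ⟩ : ∃ u : ℂ, u * (starRingEnd ℂ) u = 1 ∧ u * ξ = (‖ξ‖ : ℂ) := by
    by_cases h0 : ξ = 0
    · exact ⟨1, by simp, by simp [h0]⟩
    · have hn : (‖ξ‖ : ℂ) ≠ 0 := by simpa using h0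
      have hm : (starRingEnd ℂ) ξ * ξ = (‖ξ‖ : ℂ) ^ 2 := Complex.conj_mul' ξ
      refine ⟨(starRingEnd ℂ) ξ / ‖ξ‖, ?_, ?_⟩
      · simp only [map_div₀, Complex.conj_conj, Complex.conj_ofReal]
        field_simp
        exact hm
      · field_simp
        exact hm
  rw [← zonalSum_mul_unit l u ξ z η w hu, hξ]
  have hu' : Complex.normSq u = 1 := by
    rw [Complex.mul_conj] at hu; exact_mod_cast hu
  have h1 : Complex.normSq (‖ξ‖ : ℂ) + z ^ 2 = 1 := by
    rw [← hξ, map_mul, hu', one_mul]; exact h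
  have h2 : Complex.normSq (u * η) + w ^ 2 = 1 := by rw [map_mul, hu', one_mul]; exact h'
  have hzz : z ^ 2 + ‖ξ‖ ^ 2 = 1 := by
    rw [Complex.normSq_ofReal] at h1; linarith
  -- The angle at which the curve starting from `(‖ξ‖, z)` reaches `(0, 1)`.
  obtain ⟨t, hc, hs⟩ : ∃ t, Real.cos t = z ∧ Real.sin t = -‖ξ‖ := by
    have hn : ‖(⟨z, -‖ξ‖⟩ : ℂ)‖ = 1 := by
      rw [← sq_eq_sq₀ (norm_nonneg _) zero_le_one, Complex.sq_norm, Complex.normSq_apply]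
      linear_combination hzz
    refine ⟨Complex.arg ⟨z, -‖ξ‖⟩, ?_, ?_⟩
    · rw [Complex.cos_arg, hn]
      · simp
      · intro h0; rw [h0] at hn; simp at hn
    · rw [Complex.sin_arg, hn]; simp
  have e := zonalSum_rotationCurve l (isRotationCurve _ z h1) (isRotationCurve _ w h2) 0 t
  simp only [Real.cos_zero, Real.sin_zero, mul_one, mul_zero, add_zero, neg_zero, zero_add, hc, hs,
    Complex.ofReal_re, Complex.ofReal_im, Complex.ofReal_zero] at e
  rw [show ((u * η).re : ℂ) + Complex.I * (u * η).im = u * η by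
    rw [mul_comm Complex.I]; exact Complex.re_add_im _] at e
  rw [e, show ‖ξ‖ * z + z * -‖ξ‖ = 0 by ring, show -(‖ξ‖ * -‖ξ‖) + z * z = 1 by
    linear_combination hzz, Complex.ofReal_zero, zonalSum_pole]
  congr 1
  have hx : ‖ξ‖ * (u * η).re = ξ.re * η.re + ξ.im * η.im := by
    have e1 : (‖ξ‖ : ℂ) * (u * η) = (starRingEnd ℂ) ξ * η := by
      have := congrArg (starRingEnd ℂ) hξ
      simp only [map_mul, Complex.conj_ofReal] at this
      rw [← this]
      linear_combination (starRingEnd ℂ) ξ * η * hu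
    have e2 := congrArg Complex.re e1
    simpa using e2
  linear_combination hx

lemma sum_Icc_neg_eq {M : Type*} [AddCommMonoid M] (F : ℤ → M) (l : ℕ) :
    ∑ m ∈ Finset.Icc (-(l : ℤ)) l, F m =
      F 0 + ∑ k ∈ Finset.range l, (F (k + 1 : ℕ) + F (-(k + 1 : ℕ))) := by
  induction l with
  | zero => simp
  | succ l ih =>
    have : Finset.Icc (-((l + 1 : ℕ) : ℤ)) (l + 1 : ℕ) =
        insert ((l + 1 : ℕ) : ℤ) (insert (-((l + 1 : ℕ) : ℤ)) (Finset.Icc (-(l : ℤ)) l)) := by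
      ext m; simp only [Finset.mem_Icc, Finset.mem_insert]; omega
    rw [this, Finset.sum_insert, Finset.sum_insert, ih, Finset.sum_range_succ]
    · abel
    · simp only [Finset.mem_Icc]; omega
    · simp only [Finset.mem_Icc, Finset.mem_insert]; omega

lemma S2.sum_sq (x : S2) : x.1 0 ^ 2 + x.1 1 ^ 2 + x.1 2 ^ 2 = 1 := by
  have h : ‖x.1‖ = 1 := by simp
  have h2 := EuclideanSpace.norm_sq_eq x.1
  rw [h] at h2
  simp [Fin.sum_univ_three] at h2
  linarith

lemma S2.inner_eq (x y : S2) :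
    inner ℝ x.1 y.1 = x.1 0 * y.1 0 + x.1 1 * y.1 1 + x.1 2 * y.1 2 := by
  rw [PiLp.inner_apply]
  simp [Fin.sum_univ_three, mul_comm]

lemma sphericalHarmonic_natCast (l m : ℕ) (x : S2) :
    sphericalHarmonic l m x = (-1) ^ m *
      Real.sqrt ((2 * l + 1) / (4 * Real.pi) * factorialRatio l m) *
        solidHarmonic l m ((x.1 0 : ℂ) + Complex.I * x.1 1) (x.1 2) := by
  rw [sphericalHarmonic, if_pos (by omega), Int.natAbs_natCast, solidHarmonic, factorialRatio]
  push_cast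
  ring

lemma sphericalHarmonic_mul_conj (l m : ℕ) (x y : S2) :
    sphericalHarmonic l m x * (starRingEnd ℂ) (sphericalHarmonic l m y) =
      ((2 * l + 1) / (4 * Real.pi) * factorialRatio l m : ℝ) *
        (solidHarmonic l m ((x.1 0 : ℂ) + Complex.I * x.1 1) (x.1 2) *
          (starRingEnd ℂ) (solidHarmonic l m ((y.1 0 : ℂ) + Complex.I * y.1 1) (y.1 2))) := by
  rw [sphericalHarmonic_natCast, sphericalHarmonic_natCast]
  simp only [map_mul, map_pow, map_neg, map_one, Complex.conj_ofReal]
  have h1 : ((-1 : ℂ) ^ m) * (-1) ^ m = 1 := by rw [← mul_pow]; simp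
  have h2 : (Real.sqrt ((2 * l + 1) / (4 * Real.pi) * factorialRatio l m) : ℂ) *
    Real.sqrt ((2 * l + 1) / (4 * Real.pi) * factorialRatio l m) =
      ((2 * l + 1) / (4 * Real.pi) * factorialRatio l m : ℝ) := by
    rw [← Complex.ofReal_mul, Real.mul_self_sqrt]
    have := Real.pi_pos
    unfold factorialRatio
    positivity
  rw [← h2]
  linear_combination (Real.sqrt ((2 * l + 1) / (4 * Real.pi) * factorialRatio l m) : ℂ) *
    Real.sqrt ((2 * l + 1) / (4 * Real.pi) * factorialRatio l m) *
    (solidHarmonic l m ((x.1 0 : ℂ) + Complex.I * x.1 1) (x.1 2) *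
          (starRingEnd ℂ) (solidHarmonic l m ((y.1 0 : ℂ) + Complex.I * y.1 1) (y.1 2))) * h1

/-- The addition theorem for spherical harmonics. -/
theorem sum_sphericalHarmonic_mul_conj (l : ℕ) (x y : S2) :
    ∑ m ∈ Finset.Icc (-(l : ℤ)) l,
      sphericalHarmonic l m x * (starRingEnd ℂ) (sphericalHarmonic l m y) =
      ((2 * l + 1) / (4 * Real.pi) * (legendre l).eval (inner ℝ x.1 y.1) : ℝ) := by
  rw [sum_Icc_neg_eq]
  have hneg : ∀ k : ℕ, sphericalHarmonic l (-(k : ℤ)) x *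
      (starRingEnd ℂ) (sphericalHarmonic l (-(k : ℤ)) y) =
      (starRingEnd ℂ) (sphericalHarmonic l k x * (starRingEnd ℂ) (sphericalHarmonic l k y)) := by
    intro k
    rw [sphericalHarmonic_neg, sphericalHarmonic_neg, Int.natAbs_natCast]
    simp only [map_mul, map_pow, map_neg, map_one, Complex.conj_conj]
    have h1 : ((-1 : ℂ) ^ k) * (-1) ^ k = 1 := by rw [← mul_pow]; simp
    linear_combination ((starRingEnd ℂ) (sphericalHarmonic l k x) * sphericalHarmonic l k y) * h1
  have hx : Complex.normSq ((x.1 0 : ℂ) + Complex.I * x.1 1) + x.1 2 ^ 2 = 1 := by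
    have := S2.sum_sq x
    rw [Complex.normSq_apply]; simp; linarith
  have hy : Complex.normSq ((y.1 0 : ℂ) + Complex.I * y.1 1) + y.1 2 ^ 2 = 1 := by
    have := S2.sum_sq y
    rw [Complex.normSq_apply]; simp; linarith
  have hz := zonalSum_eq l _ _ _ _ hx hy
  simp only [Complex.add_re, Complex.add_im, Complex.ofReal_re, Complex.ofReal_im, Complex.mul_re,
    Complex.mul_im, Complex.I_re, Complex.I_im, zero_mul, one_mul, mul_zero, sub_self, add_zero,
    zero_add] at hz
  rw [S2.inner_eq, ← hz, zonalSum]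
  simp only [hneg, Complex.add_conj]
  have h0 := sphericalHarmonic_mul_conj l 0 x y
  simp only [sphericalHarmonic_mul_conj, Complex.re_ofReal_mul]
  rw [show (0 : ℤ) = ((0 : ℕ) : ℤ) from rfl, h0]
  have : factorialRatio l 0 = 1 := by rw [factorialRatio]; simp [Nat.factorial_ne_zero]
  rw [this]
  simp only [solidHarmonic, pow_zero, mul_one, Function.iterate_zero, id, Complex.conj_ofReal]
  push_cast
  rw [mul_add, Finset.mul_sum, Finset.mul_sum]
  congr 1
  refine Finset.sum_congr rfl fun m _ => ?_
  ring

end Addition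

section Rotations

open Polynomial
open scoped Pointwise

/-! ### Rotations and the surface measure -/

/-- The Euclidean space `ℝ³`. -/
local notation "ℝ³" => EuclideanSpace ℝ (Fin 3)

/-- The isometry given by an orthogonal matrix. -/
def isometryOfMatrix (A : Matrix (Fin 3) (Fin 3) ℝ) (h : A.transpose * A = 1) : ℝ³ ≃ₗᵢ[ℝ] ℝ³ :=
  LinearIsometry.toLinearIsometryEquiv (E₁ := ℝ³) (F := ℝ³) (R₁ := ℝ)
    ⟨Matrix.toEuclideanLin A, fun v => by
      rw [← sq_eq_sq₀ (norm_nonneg _) (norm_nonneg _), EuclideanSpace.real_norm_sq_eq,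
        EuclideanSpace.real_norm_sq_eq]
      have h1 : ∀ w : Fin 3 → ℝ, ∑ i, w i ^ 2 = w ⬝ᵥ w := fun w => by
        simp [dotProduct, sq]
      rw [h1, h1, show (Matrix.toEuclideanLin A v).ofLp = A.mulVec v.ofLp from rfl,
        Matrix.dotProduct_mulVec,
        Matrix.vecMul_mulVec, h, Matrix.vecMul_one]⟩ rfl

lemma isometryOfMatrix_apply (A : Matrix (Fin 3) (Fin 3) ℝ) (h : A.transpose * A = 1) (v : ℝ³)
    (i : Fin 3) : isometryOfMatrix A h v i = A i 0 * v 0 + A i 1 * v 1 + A i 2 * v 2 := by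
  have : (isometryOfMatrix A h v).ofLp = A.mulVec v.ofLp := rfl
  rw [this, Matrix.mulVec, dotProduct, Fin.sum_univ_three]

lemma det_isometryOfMatrix (A : Matrix (Fin 3) (Fin 3) ℝ) (h : A.transpose * A = 1) :
    LinearMap.det ((isometryOfMatrix A h).toLinearEquiv : ℝ³ →ₗ[ℝ] ℝ³) = A.det := by
  have : ((isometryOfMatrix A h).toLinearEquiv : ℝ³ →ₗ[ℝ] ℝ³) = Matrix.toEuclideanLin A := rfl
  rw [this]
  exact LinearMap.det_toLin (PiLp.basisFun 2 ℝ (Fin 3)) A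

/-- The point `(0, 0, 1)`. -/
def northPole : S2 := ⟨!₂[0, 0, 1], by simp [EuclideanSpace.norm_eq, Fin.sum_univ_three]⟩

lemma inner_northPole (x : S2) : inner ℝ x.1 northPole.1 = x.1 2 := by
  rw [S2.inner_eq]; simp [northPole]

lemma inner_rotate (R : ℝ³ ≃ₗᵢ[ℝ] ℝ³) (x y : S2) :
    inner ℝ (rotate R x).1 (rotate R y).1 = inner ℝ x.1 y.1 := R.inner_map_map x.1 y.1

lemma rotate_symm_rotate (R : ℝ³ ≃ₗᵢ[ℝ] ℝ³) (x : S2) : rotate R.symm (rotate R x) = x := by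
  apply Subtype.ext; simp [rotate]

lemma rotate_rotate_symm (R : ℝ³ ≃ₗᵢ[ℝ] ℝ³) (x : S2) : rotate R (rotate R.symm x) = x := by
  apply Subtype.ext; simp [rotate]

lemma det_symm_eq_one {R : ℝ³ ≃ₗᵢ[ℝ] ℝ³}
    (hR : LinearMap.det (R.toLinearEquiv : ℝ³ →ₗ[ℝ] ℝ³) = 1) :
    LinearMap.det (R.symm.toLinearEquiv : ℝ³ →ₗ[ℝ] ℝ³) = 1 := by
  have h := LinearEquiv.det_mul_det_symm R.toLinearEquiv
  rw [hR, one_mul] at h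
  exact h

lemma exists_rotate_eq_northPole (x : S2) : ∃ R : ℝ³ ≃ₗᵢ[ℝ] ℝ³,
    LinearMap.det (R.toLinearEquiv : ℝ³ →ₗ[ℝ] ℝ³) = 1 ∧ rotate R x = northPole := by
  have hx := S2.sum_sq x
  suffices h : ∃ A : Matrix (Fin 3) (Fin 3) ℝ, A.transpose * A = 1 ∧ A.det = 1 ∧
      ∀ i, A i 0 * x.1 0 + A i 1 * x.1 1 + A i 2 * x.1 2 = northPole.1 i by
    obtain ⟨A, hA, hd, hN⟩ := h
    refine ⟨isometryOfMatrix A hA, by rw [det_isometryOfMatrix, hd], ?_⟩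
    apply Subtype.ext
    ext i
    rw [← hN i]
    exact isometryOfMatrix_apply A hA x.1 i
  generalize x.1 0 = a at *
  generalize x.1 1 = b at *
  generalize x.1 2 = c at *
  by_cases h0 : a ^ 2 + b ^ 2 = 0
  · have ha : a = 0 := by nlinarith
    have hb : b = 0 := by nlinarith
    have hc : c * c = 1 := by nlinarith
    refine ⟨!![1, 0, 0; 0, c, 0; 0, 0, c], ?_, ?_, ?_⟩
    · ext i j
      fin_cases i <;> fin_cases j <;> simp [Matrix.mul_apply, Fin.sum_univ_three, hc]
    · rw [Matrix.det_fin_three]; simp [hc]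
    · intro i; fin_cases i <;> simp [northPole, ha, hb, hc]
  · obtain ⟨r, hr, hr0⟩ : ∃ r : ℝ, r ^ 2 = a ^ 2 + b ^ 2 ∧ r ≠ 0 :=
      ⟨√(a ^ 2 + b ^ 2), Real.sq_sqrt (by positivity), fun h => h0 (by
        rwa [Real.sqrt_eq_zero (by positivity)] at h)⟩
    have hrc : r ^ 2 + c ^ 2 = 1 := by rw [hr]; exact hx
    -- An orthonormal frame whose last row is the point itself, so that this matrix sends the point
    -- to the pole.
    have h2 : !![c * a / r, c * b / r, -r; -b / r, a / r, 0; a, b, c] *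
        !![c * a / r, c * b / r, -r; -b / r, a / r, 0; a, b, c].transpose = 1 := by
      ext i j
      fin_cases i <;> fin_cases j <;> simp [Matrix.mul_apply, Fin.sum_univ_three] <;>
        field_simp
      · linear_combination (-c ^ 2) * hr + r ^ 2 * hrc
      · ring
      · linear_combination (-c) * hr
      · ring
      · linear_combination - hr
      · ring
      · linear_combination (-c) * hr
      · ring
      · linear_combination hx
    refine ⟨!![c * a / r, c * b / r, -r; -b / r, a / r, 0; a, b, c],
      mul_eq_one_comm.mp h2, ?_, ?_⟩
    · rw [Matrix.det_fin_three]; simp; field_simp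
      linear_combination r ^ 2 * hrc - (c ^ 2 + r ^ 2) * hr
    · intro i; fin_cases i <;> simp [northPole] <;> field_simp
      · linear_combination (-c) * hr
      · ring
      · linear_combination hx

lemma continuous_rotate (R : ℝ³ ≃ₗᵢ[ℝ] ℝ³) : Continuous (rotate R) :=
  (R.continuous.comp continuous_subtype_val).subtype_mk _

instance : IsFiniteMeasure surfaceMeasure := by unfold surfaceMeasure; infer_instance

/-- The surface measure of a set is, up to a constant, the volume of the cone over it. An isometry
maps cones to cones and preserves volume. -/
lemma measurePreserving_rotate (R : ℝ³ ≃ₗᵢ[ℝ] ℝ³) :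
    MeasurePreserving (rotate R) surfaceMeasure surfaceMeasure := by
  refine ⟨(continuous_rotate R).measurable, ?_⟩
  ext s hs
  rw [Measure.map_apply (continuous_rotate R).measurable hs, surfaceMeasure,
    Measure.toSphere_apply' _ hs,
    Measure.toSphere_apply' _ ((continuous_rotate R).measurable hs)]
  congr 1
  have h : Set.Ioo (0 : ℝ) 1 • ((↑) '' (rotate R ⁻¹' s) : Set ℝ³) =
      R ⁻¹' (Set.Ioo (0 : ℝ) 1 • ((↑) '' s)) := by
    ext v
    simp only [Set.mem_smul, Set.mem_image, Set.mem_preimage]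
    constructor
    · rintro ⟨r, hr, _, ⟨x, hx, rfl⟩, rfl⟩
      exact ⟨r, hr, _, ⟨_, hx, rfl⟩, by simp [rotate]⟩
    · rintro ⟨r, hr, _, ⟨x, hx, rfl⟩, h⟩
      refine ⟨r, hr, _, ⟨rotate R.symm x, by rwa [rotate_rotate_symm], rfl⟩, ?_⟩
      apply R.injective
      rw [← h]
      simp [rotate]
  rw [h]
  exact R.measurePreserving.measure_preimage_equiv (f := R.toMeasurableEquiv) _

lemma integral_rotate {F : Type*} [NormedAddCommGroup F] [NormedSpace ℝ F] (R : ℝ³ ≃ₗᵢ[ℝ] ℝ³)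
    (f : S2 → F) : ∫ x, f (rotate R x) ∂surfaceMeasure = ∫ x, f x ∂surfaceMeasure := by
  have hemb : MeasurableEmbedding (rotate R) :=
    (MeasurableEquiv.mk ⟨rotate R, rotate R.symm, rotate_symm_rotate R, rotate_rotate_symm R⟩
      (continuous_rotate R).measurable (continuous_rotate R.symm).measurable).measurableEmbedding
  exact (measurePreserving_rotate R).integral_comp hemb f

lemma surfaceMeasure_univ : surfaceMeasure.real Set.univ = 4 * Real.pi := by
  rw [surfaceMeasure, Measure.toSphere_real_apply_univ, measureReal_def, EuclideanSpace.volume_ball]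
  have h : Real.Gamma ((3 : ℝ) / 2 + 1) = 3 / 4 * √Real.pi := by
    rw [Real.Gamma_add_one (by norm_num), show (3 : ℝ) / 2 = 1 / 2 + 1 by norm_num,
      Real.Gamma_add_one (by norm_num), Real.Gamma_one_half_eq]
    ring
  simp [h]
  have hp := Real.sqrt_pos.mpr Real.pi_pos
  rw [ENNReal.toReal_ofReal (by positivity)]
  have := Real.sq_sqrt Real.pi_pos.le
  field_simp
  linear_combination this

/-! ### The Funk-Hecke formula -/

lemma integrable_mul_continuous {𝕜 : Type*} [RCLike 𝕜] {f g : S2 → 𝕜}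
    (hf : Integrable f surfaceMeasure) (hg : Continuous g) :
    Integrable (fun x => f x * g x) surfaceMeasure := by
  obtain ⟨C, hC⟩ := isCompact_univ.exists_bound_of_continuousOn hg.continuousOn
  exact hf.mul_bdd hg.aestronglyMeasurable (c := C)
    (Filter.Eventually.of_forall fun x => hC x trivial)

lemma continuous_coord (i : Fin 3) : Continuous fun x : S2 => x.1 i :=
  (EuclideanSpace.proj (𝕜 := ℝ) i).continuous.comp continuous_subtype_val

lemma continuous_sphericalHarmonic (l : ℕ) (m : ℤ) : Continuous (sphericalHarmonic l m) := by
  have h0 := Complex.continuous_ofReal.comp (continuous_coord 0)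
  have h1 := Complex.continuous_ofReal.comp (continuous_coord 1)
  have h2 := continuous_coord 2
  have h3 := (derivative^[m.natAbs] (legendre l)).continuous.comp h2
  unfold sphericalHarmonic
  refine Continuous.mul (Complex.continuous_ofReal.comp (continuous_const.mul h3)) ?_
  split_ifs
  · exact continuous_const.mul ((h0.add (continuous_const.mul h1)).pow _)
  · exact (h0.sub (continuous_const.mul h1)).pow _

lemma continuous_legendre_inner (l : ℕ) (y : S2) :
    Continuous fun x : S2 => (legendre l).eval (inner ℝ x.1 y.1) :=
  (legendre l).continuous.comp (continuous_subtype_val.inner continuous_const)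

/-- The rotation about the third axis by `π/|m|` multiplies `e^{imφ}` by `-1`. Integrals of `Y_{lm}`
against functions invariant about this axis therefore vanish for `m ≠ 0`, with no need for spherical
coordinates. -/
lemma exists_rotate_sphericalHarmonic_neg (l : ℕ) {m : ℤ} (hm : m ≠ 0) : ∃ R : ℝ³ ≃ₗᵢ[ℝ] ℝ³,
    LinearMap.det (R.toLinearEquiv : ℝ³ →ₗ[ℝ] ℝ³) = 1 ∧ rotate R northPole = northPole ∧
      ∀ x, sphericalHarmonic l m (rotate R x) = -sphericalHarmonic l m x := by
  set t : ℝ := Real.pi / m.natAbs with ht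
  have hcs := Real.sin_sq_add_cos_sq t
  have hA : !![Real.cos t, -Real.sin t, 0; Real.sin t, Real.cos t, 0; 0, 0, 1].transpose *
      !![Real.cos t, -Real.sin t, 0; Real.sin t, Real.cos t, 0; 0, 0, 1] = 1 := by
    ext i j
    fin_cases i <;> fin_cases j <;> simp [Matrix.mul_apply, Fin.sum_univ_three] <;>
      nlinarith
  have happ := isometryOfMatrix_apply _ hA
  have hn : (m.natAbs : ℝ) ≠ 0 := by simpa using hm
  have hexp : (Complex.exp (t * Complex.I)) ^ m.natAbs = -1 := by
    rw [← Complex.exp_nat_mul, ← Complex.exp_pi_mul_I]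
    congr 1
    rw [← mul_assoc, ht]
    congr 1
    rw [← Complex.ofReal_natCast, ← Complex.ofReal_mul]
    congr 1
    field_simp
  have hu : Complex.exp (t * Complex.I) = Real.cos t + Complex.I * Real.sin t := by
    rw [Complex.exp_mul_I, ← Complex.ofReal_cos, ← Complex.ofReal_sin]; ring
  have hexp' : (Real.cos t - Complex.I * Real.sin t) ^ m.natAbs = -1 := by
    have := congrArg (starRingEnd ℂ) hexp
    rw [hu] at this
    simp only [map_pow, map_add, map_mul, map_neg, map_one, Complex.conj_ofReal,
      Complex.conj_I] at this
    rw [← this]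
    ring
  rw [hu] at hexp
  refine ⟨isometryOfMatrix _ hA, ?_, ?_, ?_⟩
  · rw [det_isometryOfMatrix, Matrix.det_fin_three]
    simp
    linear_combination hcs
  · apply Subtype.ext
    ext i
    refine (happ northPole.1 i).trans ?_
    fin_cases i <;> simp [northPole]
  · intro x
    have h0 : (rotate (isometryOfMatrix _ hA) x).1 0 =
      Real.cos t * x.1 0 - Real.sin t * x.1 1 := by
      refine (happ x.1 0).trans ?_; simp; ring
    have h1 : (rotate (isometryOfMatrix _ hA) x).1 1 =
      Real.sin t * x.1 0 + Real.cos t * x.1 1 := by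
      refine (happ x.1 1).trans ?_; simp
    have h2 : (rotate (isometryOfMatrix _ hA) x).1 2 = x.1 2 := by
      refine (happ x.1 2).trans ?_; simp
    unfold sphericalHarmonic
    rw [h0, h1, h2]
    split_ifs
    · have e : (((Real.cos t * x.1 0 - Real.sin t * x.1 1 : ℝ) : ℂ) +
          Complex.I * ((Real.sin t * x.1 0 + Real.cos t * x.1 1 : ℝ) : ℂ)) =
          (Real.cos t + Complex.I * Real.sin t) * ((x.1 0 : ℂ) + Complex.I * x.1 1) := by
        simp only [Complex.ofReal_sub, Complex.ofReal_add, Complex.ofReal_mul]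
        linear_combination -((Real.sin t : ℂ) * x.1 1) * Complex.I_mul_I
      rw [e, mul_pow, hexp]
      ring
    · have e : (((Real.cos t * x.1 0 - Real.sin t * x.1 1 : ℝ) : ℂ) -
          Complex.I * ((Real.sin t * x.1 0 + Real.cos t * x.1 1 : ℝ) : ℂ)) =
          (Real.cos t - Complex.I * Real.sin t) * ((x.1 0 : ℂ) - Complex.I * x.1 1) := by
        simp only [Complex.ofReal_sub, Complex.ofReal_add, Complex.ofReal_mul]
        linear_combination -((Real.sin t : ℂ) * x.1 1) * Complex.I_mul_I
      rw [e, mul_pow, hexp']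
      ring

/-- Invariance of a kernel under the rotations in `SO(3)`. -/
def RotationInvariant (G : S2 → S2 → ℝ) : Prop :=
  ∀ R : ℝ³ ≃ₗᵢ[ℝ] ℝ³, LinearMap.det (R.toLinearEquiv : ℝ³ →ₗ[ℝ] ℝ³) = 1 →
    ∀ x y, G (rotate R x) (rotate R y) = G x y

lemma sphericalHarmonic_zero (l : ℕ) (x : S2) : sphericalHarmonic l 0 x =
    (√((2 * l + 1) / (4 * Real.pi)) * (legendre l).eval (x.1 2) : ℝ) := by
  have h := sphericalHarmonic_natCast l 0 x
  have : factorialRatio l 0 = 1 := by rw [factorialRatio]; simp [Nat.factorial_ne_zero]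
  rw [this] at h
  simpa [solidHarmonic] using h

/-- Expand the Legendre kernel by the addition theorem. Since `G northPole` is invariant under the
rotations fixing the pole, only `m = 0` contributes. -/
lemma funkHecke_northPole {G : S2 → S2 → ℝ} (hG : RotationInvariant G)
    (hi : Integrable (G northPole) surfaceMeasure) (l : ℕ) (y : S2) :
    ∫ w, G northPole w * (legendre l).eval (inner ℝ w.1 y.1) ∂surfaceMeasure =
      (legendre l).eval (y.1 2) *
        ∫ w, G northPole w * (legendre l).eval (w.1 2) ∂surfaceMeasure := by
  have hzero : ∀ m : ℤ, m ≠ 0 →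
      ∫ w, (G northPole w : ℂ) * sphericalHarmonic l m w ∂surfaceMeasure = 0 := by
    intro m hm
    obtain ⟨R, hR, hN, hY⟩ := exists_rotate_sphericalHarmonic_neg l hm
    have h := integral_rotate R fun w => (G northPole w : ℂ) * sphericalHarmonic l m w
    have e : ∀ w, G northPole (rotate R w) = G northPole w := fun w => by
      conv_lhs => rw [← hN]
      exact hG R hR _ _
    simp only [e, hY, mul_neg, integral_neg] at h
    exact self_eq_neg.mp h.symm
  have hpos : (0 : ℝ) < (2 * l + 1) / (4 * Real.pi) := by have := Real.pi_pos; positivity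
  have key : ((∫ w, G northPole w * ((2 * l + 1) / (4 * Real.pi) *
        (legendre l).eval (inner ℝ w.1 y.1)) ∂surfaceMeasure : ℝ) : ℂ) =
      ((2 * l + 1) / (4 * Real.pi) * ((legendre l).eval (y.1 2) *
        ∫ w, G northPole w * (legendre l).eval (w.1 2) ∂surfaceMeasure) : ℝ) := by
    rw [← integral_complex_ofReal]
    have e : ∀ w, ((G northPole w * ((2 * l + 1) / (4 * Real.pi) *
        (legendre l).eval (inner ℝ w.1 y.1)) : ℝ) : ℂ) = ∑ m ∈ Finset.Icc (-(l : ℤ)) l,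
          (G northPole w : ℂ) * sphericalHarmonic l m w *
            (starRingEnd ℂ) (sphericalHarmonic l m y) := fun w => by
      rw [Complex.ofReal_mul, ← sum_sphericalHarmonic_mul_conj, Finset.mul_sum]
      simp only [mul_assoc]
    simp only [e]
    rw [integral_finsetSum]
    · simp only [integral_mul_const]
      rw [Finset.sum_eq_single 0]
      · simp only [sphericalHarmonic_zero, ← Complex.ofReal_mul, Complex.conj_ofReal,
          integral_complex_ofReal]
        congr 1
        simp only [mul_left_comm (G _ _), integral_const_mul]
        linear_combination ((∫ w, G northPole w * (legendre l).eval (w.1 2) ∂surfaceMeasure) *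
          (legendre l).eval (y.1 2)) * Real.mul_self_sqrt hpos.le
      · intro m _ hm
        rw [hzero m hm, zero_mul]
      · intro h; exact absurd (Finset.mem_Icc.mpr (by omega)) h
    · intro m _
      exact (integrable_mul_continuous hi.ofReal (continuous_sphericalHarmonic l m)).mul_const _
  have key' := Complex.ofReal_injective key
  simp only [mul_left_comm (G _ _), integral_const_mul] at key'
  exact mul_left_cancel₀ hpos.ne' key'

/-- The Funk-Hecke formula: Legendre kernels are eigenfunctions of rotation invariant kernels. -/
theorem funkHecke {G : S2 → S2 → ℝ} (hG : RotationInvariant G)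
    (hi : Integrable (G northPole) surfaceMeasure) (l : ℕ) (x y : S2) :
    ∫ w, G x w * (legendre l).eval (inner ℝ w.1 y.1) ∂surfaceMeasure =
      (legendre l).eval (inner ℝ x.1 y.1) *
        ∫ w, G northPole w * (legendre l).eval (w.1 2) ∂surfaceMeasure := by
  obtain ⟨R, hR, hN⟩ := exists_rotate_eq_northPole x
  rw [← inner_rotate R x y, hN, real_inner_comm, inner_northPole, ← funkHecke_northPole hG hi]
  have h := integral_rotate R fun w =>
    G northPole w * (legendre l).eval (inner ℝ w.1 (rotate R y).1)
  rw [← h]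
  have e : ∀ w, G northPole (rotate R w) = G x w := fun w => by rw [← hN, hG R hR]
  simp only [inner_rotate, e]

/-- The normalized integral over the sphere of a polynomial in the third coordinate. -/
def zonalIntegral : ℝ[X] →ₗ[ℝ] ℝ where
  toFun p := (4 * Real.pi)⁻¹ * ∫ x : S2, p.eval (x.1 2) ∂surfaceMeasure
  map_add' p q := by
    have hi : ∀ p : ℝ[X], Integrable (fun x : S2 => p.eval (x.1 2)) surfaceMeasure := fun p => by
      simpa using integrable_mul_continuous (integrable_const (1 : ℝ))
        (p.continuous.comp (continuous_coord 2))
    simp only [eval_add]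
    rw [integral_add (hi p) (hi q), mul_add]
  map_smul' c p := by
    simp only [eval_smul, smul_eq_mul, integral_const_mul, RingHom.id_apply]
    ring

lemma zonalIntegral_legendre_zero : zonalIntegral (legendre 0) = 1 := by
  have := Real.pi_pos
  simp [zonalIntegral, surfaceMeasure_univ]
  field_simp

/-- Funk-Hecke for the constant kernel gives `I = P_n(x₃) I` for the integral `I` and every point
`x`. If `I ≠ 0`, then `P_n = 1` on `[-1, 1]`, and Legendre's equation forces `n(n + 1) = 0`. -/
lemma zonalIntegral_legendre {n : ℕ} (hn : n ≠ 0) : zonalIntegral (legendre n) = 0 := by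
  have h := funkHecke (G := fun _ _ => 1) (fun _ _ _ _ => rfl) (integrable_const _) n
  have h' : ∀ x : S2, ∫ w : S2, (legendre n).eval (w.1 2) ∂surfaceMeasure =
      (legendre n).eval (x.1 2) * ∫ w : S2, (legendre n).eval (w.1 2) ∂surfaceMeasure := by
    intro x
    simpa [inner_northPole] using h x northPole
  have h0 : ∫ w : S2, (legendre n).eval (w.1 2) ∂surfaceMeasure = 0 := by
    by_contra hne
    have h1 : ∀ t ∈ Set.Icc (-1 : ℝ) 1, (legendre n).eval t = (1 : ℝ[X]).eval t := by
      intro t ht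
      have hx : 0 ≤ 1 - t ^ 2 := by nlinarith [ht.1, ht.2]
      have := h' ⟨!₂[√(1 - t ^ 2), 0, t], by
        simp [EuclideanSpace.norm_eq, Fin.sum_univ_three, Real.sq_sqrt hx]⟩
      have := mul_right_cancel₀ hne ((one_mul _).trans this)
      rw [eval_one]
      exact this.symm
    have h2 : legendre n = 1 := eq_of_infinite_eval_eq _ _
      ((Set.Icc_infinite (by norm_num : (-1 : ℝ) < 1)).mono h1)
    have h3 := congrArg (eval 0) (legendre_ode n)
    rw [h2] at h3
    simp at h3
    rcases h3 with h3 | h3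
    · exact hn h3
    · norm_cast at h3
  simp [zonalIntegral, h0]

lemma integral_legendre_triple (l m n : ℕ) :
    ∫ x : S2, (legendre l).eval (x.1 2) * (legendre m).eval (x.1 2) * (legendre n).eval (x.1 2)
      ∂surfaceMeasure = 4 * Real.pi * wigner3j l m n 0 0 0 ^ 2 := by
  rw [← map_legendre_triple zonalIntegral zonalIntegral_legendre_zero
    (fun n hn => zonalIntegral_legendre hn)]
  have := Real.pi_pos
  simp [zonalIntegral]
  field_simp

lemma integral_legendre_mul (m n : ℕ) :
    ∫ x : S2, (legendre m).eval (x.1 2) * (legendre n).eval (x.1 2) ∂surfaceMeasure =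
      if m = n then 4 * Real.pi / (2 * m + 1) else 0 := by
  have h := integral_legendre_triple 0 m n
  rw [wigner3j_zero_left_sq] at h
  simp only [legendre_zero, eval_one, one_mul] at h
  rw [h]
  split_ifs <;> ring

/-- The reproducing property of the Legendre kernels. -/
lemma integral_legendre_inner_mul (m n : ℕ) (x y : S2) :
    ∫ w : S2, (legendre m).eval (inner ℝ x.1 w.1) * (legendre n).eval (inner ℝ w.1 y.1)
      ∂surfaceMeasure =
      if m = n then 4 * Real.pi / (2 * m + 1) * (legendre m).eval (inner ℝ x.1 y.1) else 0 := by
  have h := funkHecke (G := fun x w : S2 => (legendre m).eval (inner ℝ x.1 w.1))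
    (fun R _ x y => by simp only [inner_rotate]) (by
      simpa [real_inner_comm] using integrable_mul_continuous (integrable_const (1 : ℝ))
        (continuous_legendre_inner m northPole)) n x y
  rw [h]
  have e : ∀ w : S2, inner ℝ northPole.1 w.1 = w.1 2 := fun w => by
    rw [real_inner_comm, inner_northPole]
  simp only [e]
  rw [integral_legendre_mul]
  split_ifs with h
  · rw [h]; ring
  · simp

end Rotations

/-! ### Integrals of second order random fields -/

section SecondOrder


variable {α Ω : Type*} [TopologicalSpace α] [CompactSpace α] [MeasurableSpace α]
  [OpensMeasurableSpace α] [MeasurableSpace Ω]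

/-- A jointly measurable random field with uniformly bounded second moments. -/
structure IsSecondOrderField (U : α → Ω → ℝ) (P : Measure Ω) : Prop where
  measurable : Measurable (fun p : α × Ω => U p.1 p.2)
  memLp : ∀ x, MemLp (U x) 2 P
  bounded : ∃ M, ∀ x, ∫ ω, U x ω ^ 2 ∂P ≤ M

/-- The random variable `∫ U(x) f(x) dμ(x)`. -/
def fieldIntegral (μ : Measure α) (U : α → Ω → ℝ) (f : α → ℝ) (ω : Ω) : ℝ :=
  ∫ x, U x ω * f x ∂μ

variable {μ : Measure α} [IsFiniteMeasure μ] {P : Measure Ω} [IsProbabilityMeasure P]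
  {U : α → Ω → ℝ} {f g : α → ℝ}

/-- Cauchy-Schwarz against the constant `1`, from the nonnegativity of the integral of `(m h - I)²`.
-/
lemma sq_integral_le (h : α → ℝ) (hh : Integrable h μ) (hh2 : Integrable (fun x => h x ^ 2) μ) :
    (∫ x, h x ∂μ) ^ 2 ≤ μ.real Set.univ * ∫ x, h x ^ 2 ∂μ := by
  rcases eq_or_ne μ 0 with rfl | hμ
  · simp
  have hm : 0 < μ.real Set.univ := by
    have := Measure.measure_univ_ne_zero.mpr hμ
    exact ENNReal.toReal_pos this (measure_ne_top _ _)
  set m := μ.real Set.univ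
  set I := ∫ x, h x ∂μ
  have h1 : 0 ≤ ∫ x, (m * h x - I) ^ 2 ∂μ := integral_nonneg fun x => sq_nonneg _
  have h2 : ∫ x, (m * h x - I) ^ 2 ∂μ = m * (m * ∫ x, h x ^ 2 ∂μ - I ^ 2) := by
    have e : ∀ x, (m * h x - I) ^ 2 = m ^ 2 * h x ^ 2 - 2 * m * I * h x + I ^ 2 := fun x => by ring
    simp only [e]
    have i1 : Integrable (fun x => m ^ 2 * h x ^ 2) μ := hh2.const_mul _
    have i2 : Integrable (fun x => 2 * m * I * h x) μ := hh.const_mul _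
    have i3 : Integrable (fun x => m ^ 2 * h x ^ 2 - 2 * m * I * h x) μ := i1.sub i2
    rw [integral_add i3 (integrable_const _), integral_sub i1 i2, integral_const_mul,
      integral_const_mul, integral_const, smul_eq_mul]
    ring
  rw [h2] at h1
  nlinarith [(mul_nonneg_iff_of_pos_left hm).mp h1]

lemma IsSecondOrderField.memLp_prod (hU : IsSecondOrderField U P) :
    MemLp (fun p : α × Ω => U p.1 p.2) 2 (μ.prod P) := by
  rw [memLp_two_iff_integrable_sq hU.measurable.aestronglyMeasurable,
    integrable_prod_iff (hU.measurable.pow_const 2).aestronglyMeasurable]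
  refine ⟨Filter.Eventually.of_forall fun x => (hU.memLp x).integrable_sq, ?_⟩
  obtain ⟨M, hM⟩ := hU.bounded
  refine Integrable.of_bound (C := M) ?_ (Filter.Eventually.of_forall fun x => ?_)
  · exact ((hU.measurable.pow_const
      2).norm.stronglyMeasurable.integral_prod_right').aestronglyMeasurable
  · simp only [Real.norm_eq_abs, abs_pow, sq_abs]
    rw [abs_of_nonneg (integral_nonneg fun ω => sq_nonneg _)]
    exact hM x

lemma IsSecondOrderField.memLp_prod_mul (hU : IsSecondOrderField U P) (hf : Continuous f) :
    MemLp (fun p : α × Ω => U p.1 p.2 * f p.1) 2 (μ.prod P) := by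
  obtain ⟨C, hC⟩ := isCompact_univ.exists_bound_of_continuousOn hf.continuousOn
  refine (hU.memLp_prod.const_mul C).mono
    ((hU.measurable.mul (hf.measurable.comp measurable_fst)).aestronglyMeasurable)
    (Filter.Eventually.of_forall fun p => ?_)
  rw [norm_mul, norm_mul, mul_comm]
  exact mul_le_mul_of_nonneg_right ((hC p.1 trivial).trans (le_abs_self C)) (norm_nonneg _)

/-- Paths are integrable only almost surely, and linearity of the integral in the test function is
used on this event. The event does not depend on the test function, so one null set serves all
points at once. -/
lemma IsSecondOrderField.ae_integrable (hU : IsSecondOrderField U P) :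
    ∀ᵐ ω ∂P, Integrable (fun x => U x ω) μ :=
  ((hU.memLp_prod (μ := μ)).integrable one_le_two).prod_left_ae

lemma integrable_field_mul {u : α → ℝ} (hu : Integrable u μ) (hf : Continuous f) :
    Integrable (fun x => u x * f x) μ := by
  obtain ⟨C, hC⟩ := isCompact_univ.exists_bound_of_continuousOn hf.continuousOn
  exact hu.mul_bdd hf.measurable.aestronglyMeasurable (c := C)
    (Filter.Eventually.of_forall fun x => hC x trivial)

lemma IsSecondOrderField.stronglyMeasurable_fieldIntegral (hU : IsSecondOrderField U P)
    (hf : Continuous f) : StronglyMeasurable (fieldIntegral μ U f) :=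
  ((hU.measurable.mul (hf.measurable.comp measurable_fst)).stronglyMeasurable).integral_prod_left'

lemma IsSecondOrderField.memLp_fieldIntegral (hU : IsSecondOrderField U P) (hf : Continuous f) :
    MemLp (fieldIntegral μ U f) 2 P := by
  have hp := hU.memLp_prod_mul (μ := μ) hf
  have hm := hU.stronglyMeasurable_fieldIntegral (μ := μ) hf
  rw [memLp_two_iff_integrable_sq hm.aestronglyMeasurable]
  have h2 := hp.integrable_sq
  refine ((h2.integral_prod_right).const_mul (μ.real Set.univ)).mono'
    ((hm.measurable.pow_const 2).aestronglyMeasurable) ?_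
  filter_upwards [h2.prod_left_ae, (hp.integrable one_le_two).prod_left_ae] with ω h3 h4
  rw [Real.norm_eq_abs, abs_of_nonneg (sq_nonneg _)]
  exact sq_integral_le _ h4 h3

/-- Fubini for the product of a square integrable variable with an integral of the field. -/
lemma IsSecondOrderField.integral_mul_fieldIntegral (hU : IsSecondOrderField U P)
    (hf : Continuous f) {Y : Ω → ℝ} (hY : MemLp Y 2 P) :
    ∫ ω, Y ω * fieldIntegral μ U f ω ∂P = ∫ x, (∫ ω, Y ω * U x ω ∂P) * f x ∂μ := by
  have hi : Integrable (fun p : α × Ω => Y p.2 * (U p.1 p.2 * f p.1)) (μ.prod P) :=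
    (hY.comp_snd μ).integrable_mul (hU.memLp_prod_mul hf)
  simp only [fieldIntegral, ← integral_const_mul, ← integral_mul_const, mul_assoc]
  exact (integral_integral_swap hi).symm

lemma IsSecondOrderField.integral_fieldIntegral (hU : IsSecondOrderField U P)
    (hf : Continuous f) :
    ∫ ω, fieldIntegral μ U f ω ∂P = ∫ x, (∫ ω, U x ω ∂P) * f x ∂μ := by
  simpa using hU.integral_mul_fieldIntegral (μ := μ) hf (memLp_const (1 : ℝ))

lemma IsSecondOrderField.integral_fieldIntegral_mul (hU : IsSecondOrderField U P)
    (hf : Continuous f) (hg : Continuous g) :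
    ∫ ω, fieldIntegral μ U f ω * fieldIntegral μ U g ω ∂P =
      ∫ y, (∫ x, (∫ ω, U x ω * U y ω ∂P) * f x ∂μ) * g y ∂μ := by
  rw [hU.integral_mul_fieldIntegral hg (hU.memLp_fieldIntegral hf)]
  congr 1
  ext y
  congr 1
  have := hU.integral_mul_fieldIntegral (μ := μ) hf (hU.memLp y)
  simp only [mul_comm (U y _)] at this
  exact this

lemma fieldIntegral_const_mul (c : ℝ) (ω : Ω) :
    fieldIntegral μ U (fun x => c * f x) ω = c * fieldIntegral μ U f ω := by
  simp only [fieldIntegral, mul_left_comm _ c, integral_const_mul]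

lemma fieldIntegral_sum {ι : Type*} (s : Finset ι) {F : ι → α → ℝ} (hF : ∀ i, Continuous (F i))
    (c : ι → ℝ) {ω : Ω} (hω : Integrable (fun x => U x ω) μ) :
    fieldIntegral μ U (fun x => ∑ i ∈ s, c i * F i x) ω =
      ∑ i ∈ s, c i * fieldIntegral μ U (F i) ω := by
  have h : ∀ i ∈ s, Integrable (fun x => U x ω * (c i * F i x)) μ := fun i _ =>
    integrable_field_mul hω (continuous_const.mul (hF i))
  simp only [← fieldIntegral_const_mul]
  simp only [fieldIntegral, Finset.mul_sum]
  rw [integral_finsetSum _ h]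

lemma fieldIntegral_add (hf : Continuous f) (hg : Continuous g) {ω : Ω}
    (hω : Integrable (fun x => U x ω) μ) :
    fieldIntegral μ U (fun x => f x + g x) ω = fieldIntegral μ U f ω + fieldIntegral μ U g ω := by
  simp only [fieldIntegral, mul_add]
  exact integral_add (integrable_field_mul hω hf) (integrable_field_mul hω hg)

lemma fieldIntegral_sub (hf : Continuous f) (hg : Continuous g) {ω : Ω}
    (hω : Integrable (fun x => U x ω) μ) :
    fieldIntegral μ U (fun x => f x - g x) ω = fieldIntegral μ U f ω - fieldIntegral μ U g ω := by
  simp only [fieldIntegral, mul_sub]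
  exact integral_sub (integrable_field_mul hω hf) (integrable_field_mul hω hg)

/-! ### Integrals of Gaussian fields -/

/-- The map `X ↦ E exp(iX)` is continuous on `L²`. -/
lemma continuous_integral_cexp :
    Continuous fun X : Lp ℝ 2 P => ∫ ω, Complex.exp (X ω * Complex.I) ∂P := by
  refine LipschitzWith.continuous (K := 1) (LipschitzWith.of_dist_le_mul fun X Y => ?_)
  have hi : ∀ X : Lp ℝ 2 P, Integrable (fun ω => Complex.exp (X ω * Complex.I)) P := fun X => by
    refine Integrable.of_bound (C := 1) ?_ (Filter.Eventually.of_forall fun ω => ?_)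
    · have := (Lp.stronglyMeasurable X).measurable
      exact (Complex.measurable_exp.comp
        ((Complex.measurable_ofReal.comp this).mul_const _)).aestronglyMeasurable
    · rw [Complex.norm_exp_ofReal_mul_I]
  rw [dist_eq_norm, ← integral_sub (hi X) (hi Y), NNReal.coe_one, one_mul, dist_eq_norm]
  have h1 : Integrable (fun ω => ‖(X - Y : Lp ℝ 2 P) ω‖) P :=
    ((Lp.memLp (X - Y)).integrable one_le_two).norm
  refine (norm_integral_le_of_norm_le h1 ?_).trans ?_
  · filter_upwards [Lp.coeFn_sub X Y] with ω hω
    rw [hω, Pi.sub_apply]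
    have e : Complex.exp (X ω * Complex.I) - Complex.exp (Y ω * Complex.I) =
        Complex.exp (Y ω * Complex.I) * (Complex.exp (Complex.I * ((X ω - Y ω : ℝ) : ℂ)) - 1) := by
      rw [mul_sub, ← Complex.exp_add, mul_one]
      congr 2
      push_cast; ring
    rw [e, norm_mul, Complex.norm_exp_ofReal_mul_I, one_mul]
    exact Real.norm_exp_I_mul_ofReal_sub_one_le
  · rw [Lp.norm_def]
    have h2 := eLpNorm_le_eLpNorm_of_exponent_le (μ := P) (p := 1) (q := 2) one_le_two
      (Lp.stronglyMeasurable (X - Y)).aestronglyMeasurable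
    rw [integral_norm_eq_lintegral_enorm (Lp.stronglyMeasurable (X - Y)).aestronglyMeasurable,
      ← eLpNorm_one_eq_lintegral_enorm]
    exact ENNReal.toReal_mono (Lp.eLpNorm_ne_top _) h2

lemma norm_toLp_sq {X : Ω → ℝ} (hX : MemLp X 2 P) : ‖hX.toLp X‖ ^ 2 = ∫ ω, X ω ^ 2 ∂P := by
  rw [← real_inner_self_eq_norm_sq, L2.inner_def]
  refine integral_congr_ae ?_
  filter_upwards [hX.coeFn_toLp] with ω hω
  rw [hω]; simp [sq]

lemma integral_cexp_of_gaussian {X : Ω → ℝ} (hX : HasGaussianLaw X P) (h0 : ∫ ω, X ω ∂P = 0) :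
    ∫ ω, Complex.exp (X ω * Complex.I) ∂P = Complex.exp (-((∫ ω, X ω ^ 2 ∂P : ℝ) : ℂ) / 2) := by
  have h := hX.charFun_map_eq 1
  rw [charFun_apply_real, integral_map hX.aemeasurable (by fun_prop)] at h
  simp only [Complex.ofReal_one, one_mul] at h
  rw [h]
  simp only [RCLike.inner_apply, conj_trivial, mul_one, h0]
  rw [variance_of_integral_eq_zero hX.aemeasurable h0]
  simp [neg_div]

/-- The integral of a centred Gaussian field has a Gaussian characteristic function. -/
lemma integral_cexp_fieldIntegral (hU : IsSecondOrderField U P) (hG : IsGaussianProcess U P)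
    (h0 : ∀ x, ∫ ω, U x ω ∂P = 0) (hf : Continuous f) :
    ∫ ω, Complex.exp (fieldIntegral μ U f ω * Complex.I) ∂P =
      Complex.exp (-((∫ ω, fieldIntegral μ U f ω ^ 2 ∂P : ℝ) : ℂ) / 2) := by
  let v : α → Lp ℝ 2 P := fun x => (hU.memLp x).toLp (U x)
  let K : Submodule ℝ (Lp ℝ 2 P) := Submodule.span ℝ (Set.range v)
  have hI := hU.memLp_fieldIntegral (μ := μ) hf
  -- Any `Y` orthogonal to all `U x` is orthogonal to the integral, by Fubini. So the integral lies
  -- in the closed span, without approximation by Riemann sums or continuity of the field.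
  have hmem : hI.toLp (fieldIntegral μ U f) ∈ K.topologicalClosure := by
    rw [← Submodule.orthogonal_orthogonal_eq_closure, Submodule.mem_orthogonal]
    intro Y hY
    rw [Submodule.mem_orthogonal'] at hY
    have hin : ∀ {X : Ω → ℝ} (hX : MemLp X 2 P), inner ℝ Y (hX.toLp X) = ∫ ω, Y ω * X ω ∂P := by
      intro X hX
      rw [L2.inner_def]
      refine integral_congr_ae ?_
      filter_upwards [hX.coeFn_toLp] with ω hω
      rw [hω]; simp [mul_comm]
    rw [hin, hU.integral_mul_fieldIntegral hf (Lp.memLp Y)]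
    have : ∀ x, ∫ ω, Y ω * U x ω ∂P = 0 := fun x => by
      rw [← hin (hU.memLp x)]
      exact hY _ (Submodule.subset_span ⟨x, rfl⟩)
    simp [this]
  -- The characteristic function identity is a closed condition in `L²` and holds for the finite
  -- linear combinations, which are Gaussian.
  have hclosed : IsClosed {X : Lp ℝ 2 P | ∫ ω, Complex.exp (X ω * Complex.I) ∂P =
      Complex.exp (-((‖X‖ ^ 2 : ℝ) : ℂ) / 2)} :=
    isClosed_eq continuous_integral_cexp (by fun_prop)
  have hsub : (K : Set (Lp ℝ 2 P)) ⊆ {X : Lp ℝ 2 P | ∫ ω, Complex.exp (X ω * Complex.I) ∂P =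
      Complex.exp (-((‖X‖ ^ 2 : ℝ) : ℂ) / 2)} := by
    intro X hX
    obtain ⟨c, rfl⟩ := (Finsupp.mem_span_range_iff_exists_finsupp).mp hX
    set S : Ω → ℝ := fun ω => ∑ x ∈ c.support, c x • U x ω with hS
    have hSg : HasGaussianLaw S P := (hG.smul c).hasGaussianLaw_fun_sum
    have hS2 : MemLp S 2 P := hSg.memLp_two
    have hS0 : ∫ ω, S ω ∂P = 0 := by
      simp only [hS, smul_eq_mul]
      rw [integral_finsetSum _ fun x _ => ((hU.memLp x).integrable one_le_two).const_mul _]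
      simp [integral_const_mul, h0]
    have heq : (c.sum fun x a => a • v x) = hS2.toLp S := by
      apply Lp.ext
      refine Filter.EventuallyEq.trans ?_ hS2.coeFn_toLp.symm
      have h1 : ((c.sum fun x a => a • v x : Lp ℝ 2 P) : Ω → ℝ) =ᵐ[P]
          ∑ x ∈ c.support, ((c x • v x : Lp ℝ 2 P) : Ω → ℝ) := by
        rw [Finsupp.sum]
        exact Lp.coeFn_finsetSum _ _
      have h2 : ∀ᵐ ω ∂P, ∀ x ∈ c.support, (c x • v x : Lp ℝ 2 P) ω = c x • U x ω := by
        rw [Filter.eventually_all_finset]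
        intro x _
        filter_upwards [Lp.coeFn_smul (c x) (v x), (hU.memLp x).coeFn_toLp] with ω h3 h4
        rw [h3, Pi.smul_apply, h4]
      filter_upwards [h1, h2] with ω h3 h4
      rw [h3, Finset.sum_apply]
      exact Finset.sum_congr rfl h4
    rw [heq, Set.mem_ofPred_eq, norm_toLp_sq, ← integral_cexp_of_gaussian hSg hS0]
    refine integral_congr_ae ?_
    filter_upwards [hS2.coeFn_toLp] with ω hω
    rw [hω]
  have := closure_minimal hsub hclosed hmem
  rw [Set.mem_ofPred_eq, norm_toLp_sq] at this
  rw [← this]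
  refine integral_congr_ae ?_
  filter_upwards [hI.coeFn_toLp] with ω hω
  rw [hω]

/-- Finitely many integrals of a centred Gaussian field have the same law as soon as they have
the same covariances. -/
lemma identDistrib_fieldIntegral (hU : IsSecondOrderField U P) (hG : IsGaussianProcess U P)
    (h0 : ∀ x, ∫ ω, U x ω ∂P = 0) {ι : Type*} [Fintype ι] {F H : ι → α → ℝ}
    (hF : ∀ i, Continuous (F i)) (hH : ∀ i, Continuous (H i))
    (hcov : ∀ i k, ∫ ω, fieldIntegral μ U (F i) ω * fieldIntegral μ U (F k) ω ∂P =
      ∫ ω, fieldIntegral μ U (H i) ω * fieldIntegral μ U (H k) ω ∂P) :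
    IdentDistrib (fun ω i => fieldIntegral μ U (F i) ω) (fun ω i => fieldIntegral μ U (H i) ω)
      P P := by
  classical
  have hmeas : ∀ {F : ι → α → ℝ}, (∀ i, Continuous (F i)) →
      Measurable (fun ω i => fieldIntegral μ U (F i) ω) := fun hF =>
    measurable_pi_lambda _ fun i => (hU.stronglyMeasurable_fieldIntegral (hF i)).measurable
  -- A linear combination of integrals is the integral of the combined test function, so the joint
  -- characteristic function depends only on the covariances.
  have hchar : ∀ {F : ι → α → ℝ}, (∀ i, Continuous (F i)) → ∀ L : StrongDual ℝ (ι → ℝ),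
      charFunDual (P.map fun ω i => fieldIntegral μ U (F i) ω) L =
      Complex.exp (-((∑ i, ∑ k, L (Pi.single i 1) * L (Pi.single k 1) *
        ∫ ω, fieldIntegral μ U (F i) ω * fieldIntegral μ U (F k) ω ∂P : ℝ) : ℂ) / 2) := by
    intro F hF L
    have hL : ∀ᵐ ω ∂P, L (fun i => fieldIntegral μ U (F i) ω) =
        fieldIntegral μ U (fun x => ∑ i, L (Pi.single i 1) * F i x) ω := by
      filter_upwards [hU.ae_integrable (μ := μ)] with ω hω
      rw [fieldIntegral_sum _ hF _ hω]
      conv_lhs => rw [pi_eq_sum_univ' (fun i => fieldIntegral μ U (F i) ω), map_sum]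
      refine Finset.sum_congr rfl fun i _ => ?_
      rw [map_smul, smul_eq_mul, mul_comm]
    have hcont : Continuous fun x => ∑ i, L (Pi.single i 1) * F i x := by fun_prop
    rw [charFunDual_apply, integral_map (hmeas hF).aemeasurable (by fun_prop)]
    have h1 := integral_cexp_fieldIntegral (μ := μ) hU hG h0 hcont
    rw [integral_congr_ae (g := fun ω => Complex.exp
      (fieldIntegral μ U (fun x => ∑ i, L (Pi.single i 1) * F i x) ω * Complex.I)) (by
        filter_upwards [hL] with ω hω
        rw [hω]), h1]
    congr 4
    have hi : ∀ i k, Integrable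
        (fun ω => fieldIntegral μ U (F i) ω * fieldIntegral μ U (F k) ω) P := fun i k =>
      (hU.memLp_fieldIntegral (hF i)).integrable_mul (hU.memLp_fieldIntegral (hF k))
    simp only [← integral_const_mul]
    simp_rw [← integral_finsetSum _ fun k _ => (hi _ k).const_mul _]
    rw [← integral_finsetSum _ fun i _ => integrable_finsetSum _ fun k _ => (hi i k).const_mul _]
    refine integral_congr_ae ?_
    filter_upwards [hU.ae_integrable (μ := μ)] with ω hω
    rw [fieldIntegral_sum _ hF _ hω, sq, Finset.sum_mul_sum]
    refine Finset.sum_congr rfl fun i _ => Finset.sum_congr rfl fun k _ => ?_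
    ring
  refine ⟨(hmeas hF).aemeasurable, (hmeas hH).aemeasurable, ?_⟩
  have := Measure.isProbabilityMeasure_map (μ := P) (hmeas hF).aemeasurable
  have := Measure.isProbabilityMeasure_map (μ := P) (hmeas hH).aemeasurable
  refine Measure.ext_of_charFunDual ?_
  ext L
  rw [hchar hF, hchar hH]
  simp only [hcov]

/-! ### Fourth moments and Wick's formula. -/

lemma iteratedDeriv_four_exp_sq (v : ℝ) :
    iteratedDeriv 4 (fun t : ℝ => Real.exp (v * t ^ 2 / 2)) 0 = 3 * v ^ 2 := by
  have hd : ∀ (p p' : ℝ → ℝ) (_ : ∀ t, HasDerivAt p (p' t) t),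
      deriv (fun t => p t * Real.exp (v * t ^ 2 / 2)) =
        fun t => (p' t + p t * (v * t)) * Real.exp (v * t ^ 2 / 2) := by
    intro p p' hp
    ext t
    have h1 : HasDerivAt (fun t : ℝ => v * t ^ 2 / 2) (v * t) t := by
      refine (((hasDerivAt_pow 2 t).const_mul v).div_const 2).congr_deriv ?_
      simp; ring
    rw [((hp t).fun_mul h1.exp).deriv]
    ring
  have e1 := hd (fun _ => 1) (fun _ => 0) (fun t => hasDerivAt_const t 1)
  simp only [one_mul, zero_add] at e1
  have e2 := hd (fun t => v * t) (fun _ => v) (fun t => by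
    simpa using (hasDerivAt_id t).const_mul v)
  have e3 := hd (fun t => v + v * t * (v * t)) (fun t => 2 * v ^ 2 * t) (fun t => by
    refine ((((hasDerivAt_id t).const_mul v).mul ((hasDerivAt_id t).const_mul v)).const_add
      v).congr_deriv ?_
    simp; ring)
  have e4 := hd (fun t => 2 * v ^ 2 * t + (v + v * t * (v * t)) * (v * t))
    (fun t => 3 * v ^ 2 + 3 * v ^ 3 * t ^ 2) (fun t => by
    have h1 : HasDerivAt (fun t : ℝ => 3 * v ^ 2 * t + v ^ 3 * t ^ 3)
        (3 * v ^ 2 + v ^ 3 * (3 * t ^ 2)) t := by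
      simpa using ((hasDerivAt_id t).const_mul (3 * v ^ 2)).fun_add
        ((hasDerivAt_pow 3 t).const_mul (v ^ 3))
    refine (h1.congr_of_eventuallyEq (Filter.Eventually.of_forall fun s => ?_)).congr_deriv ?_
    · simp only; ring
    · ring)
  simp only [iteratedDeriv_succ, iteratedDeriv_zero, e1, e2, e3, e4]
  simp

lemma integral_pow_four_gaussianReal (v : NNReal) :
    ∫ x, x ^ 4 ∂(gaussianReal 0 v) = 3 * (v : ℝ) ^ 2 := by
  have h := iteratedDeriv_mgf_zero (X := id) (μ := gaussianReal 0 v) (by simp) 4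
  rw [mgf_id_gaussianReal] at h
  simp only [zero_mul, zero_add, iteratedDeriv_four_exp_sq] at h
  simpa using h.symm

/-- Replacing `f` by `t f` turns the formula for `E exp(iX)` into the full characteristic function.
Zero variance is included. -/
lemma map_fieldIntegral (hU : IsSecondOrderField U P) (hG : IsGaussianProcess U P)
    (h0 : ∀ x, ∫ ω, U x ω ∂P = 0) (hf : Continuous f) :
    P.map (fieldIntegral μ U f) =
      gaussianReal 0 (∫ ω, fieldIntegral μ U f ω ^ 2 ∂P).toNNReal := by
  have hm := (hU.stronglyMeasurable_fieldIntegral (μ := μ) hf).measurable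
  have := Measure.isProbabilityMeasure_map (μ := P) hm.aemeasurable
  refine Measure.ext_of_charFun ?_
  ext t
  rw [charFun_apply_real, integral_map hm.aemeasurable (by fun_prop), charFun_gaussianReal,
    Real.coe_toNNReal _ (integral_nonneg fun ω => sq_nonneg _)]
  have h := integral_cexp_fieldIntegral (μ := μ) (f := fun x => t * f x) hU hG h0
    (continuous_const.mul hf)
  simp only [fieldIntegral_const_mul, mul_pow, integral_const_mul] at h
  push_cast at h ⊢
  rw [h]
  congr 1
  ring

lemma memLp_four_fieldIntegral (hU : IsSecondOrderField U P) (hG : IsGaussianProcess U P)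
    (h0 : ∀ x, ∫ ω, U x ω ∂P = 0) (hf : Continuous f) : MemLp (fieldIntegral μ U f) 4 P := by
  have hm := (hU.stronglyMeasurable_fieldIntegral (μ := μ) hf).measurable
  have h := memLp_id_gaussianReal' (μ := 0)
    (v := (∫ ω, fieldIntegral μ U f ω ^ 2 ∂P).toNNReal) 4 (by simp)
  rw [← map_fieldIntegral hU hG h0 hf, memLp_map_measure_iff (by fun_prop) hm.aemeasurable] at h
  exact h

lemma integral_fieldIntegral_pow_four (hU : IsSecondOrderField U P) (hG : IsGaussianProcess U P)
    (h0 : ∀ x, ∫ ω, U x ω ∂P = 0) (hf : Continuous f) :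
    ∫ ω, fieldIntegral μ U f ω ^ 4 ∂P = 3 * (∫ ω, fieldIntegral μ U f ω ^ 2 ∂P) ^ 2 := by
  have hm := (hU.stronglyMeasurable_fieldIntegral (μ := μ) hf).measurable
  have h := integral_map (μ := P) hm.aemeasurable (f := fun x : ℝ => x ^ 4) (by fun_prop)
  rw [map_fieldIntegral hU hG h0 hf, integral_pow_four_gaussianReal,
    Real.coe_toNNReal _ (integral_nonneg fun ω => sq_nonneg _)] at h
  exact h.symm

/-- Wick's formula for the squares of two integrals of a centred Gaussian field. -/
lemma integral_sq_mul_sq_fieldIntegral (hU : IsSecondOrderField U P) (hG : IsGaussianProcess U P)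
    (h0 : ∀ x, ∫ ω, U x ω ∂P = 0) (hf : Continuous f) (hg : Continuous g) :
    ∫ ω, fieldIntegral μ U f ω ^ 2 * fieldIntegral μ U g ω ^ 2 ∂P =
      (∫ ω, fieldIntegral μ U f ω ^ 2 ∂P) * (∫ ω, fieldIntegral μ U g ω ^ 2 ∂P) +
        2 * (∫ ω, fieldIntegral μ U f ω * fieldIntegral μ U g ω ∂P) ^ 2 := by
  set X := fieldIntegral μ U f
  set Y := fieldIntegral μ U g
  have hX : MemLp X 4 P := memLp_four_fieldIntegral hU hG h0 hf
  have hY : MemLp Y 4 P := memLp_four_fieldIntegral hU hG h0 hg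
  have hX2 : MemLp X 2 P := hU.memLp_fieldIntegral hf
  have hY2 : MemLp Y 2 P := hU.memLp_fieldIntegral hg
  have hadd : fieldIntegral μ U (fun x => f x + g x) =ᵐ[P] fun ω => X ω + Y ω := by
    filter_upwards [hU.ae_integrable (μ := μ)] with ω hω
    exact fieldIntegral_add hf hg hω
  have hsub : fieldIntegral μ U (fun x => f x - g x) =ᵐ[P] fun ω => X ω - Y ω := by
    filter_upwards [hU.ae_integrable (μ := μ)] with ω hω
    exact fieldIntegral_sub hf hg hω
  have i4 : ∀ {Z : Ω → ℝ}, MemLp Z 4 P → Integrable (fun ω => Z ω ^ 4) P := fun hZ => by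
    have := hZ.integrable_norm_pow (p := 4) (by norm_num)
    simpa [Even.pow_abs (⟨2, rfl⟩ : Even 4)] using this
  have a : ∫ ω, fieldIntegral μ U (fun x => f x + g x) ω ^ 4 ∂P =
      3 * (∫ ω, fieldIntegral μ U (fun x => f x + g x) ω ^ 2 ∂P) ^ 2 :=
    integral_fieldIntegral_pow_four (μ := μ) hU hG h0 (hf.add hg)
  have b : ∫ ω, fieldIntegral μ U (fun x => f x - g x) ω ^ 4 ∂P =
      3 * (∫ ω, fieldIntegral μ U (fun x => f x - g x) ω ^ 2 ∂P) ^ 2 :=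
    integral_fieldIntegral_pow_four (μ := μ) hU hG h0 (hf.sub hg)
  have c : ∫ ω, X ω ^ 4 ∂P = _ := integral_fieldIntegral_pow_four (μ := μ) hU hG h0 hf
  have d : ∫ ω, Y ω ^ 4 ∂P = _ := integral_fieldIntegral_pow_four (μ := μ) hU hG h0 hg
  have hpow : ∀ {Z W : Ω → ℝ}, Z =ᵐ[P] W → ∀ n : ℕ, ∫ ω, Z ω ^ n ∂P = ∫ ω, W ω ^ n ∂P :=
    fun h n => integral_congr_ae (h.pow_const n)
  rw [hpow hadd, hpow hadd] at a
  rw [hpow hsub, hpow hsub] at b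
  have hXY : Integrable (fun ω => X ω * Y ω) P := hX2.integrable_mul hY2
  have j1 : Integrable (fun ω => X ω ^ 2) P := hX2.integrable_sq
  have j2 : Integrable (fun ω => 2 * (X ω * Y ω)) P := hXY.const_mul 2
  have j3 : Integrable (fun ω => Y ω ^ 2) P := hY2.integrable_sq
  have j4 : Integrable (fun ω => X ω ^ 2 + 2 * (X ω * Y ω)) P := j1.add j2
  have j5 : Integrable (fun ω => X ω ^ 2 - 2 * (X ω * Y ω)) P := j1.sub j2
  have q1 : ∫ ω, (X ω + Y ω) ^ 2 ∂P =
      ∫ ω, X ω ^ 2 ∂P + 2 * ∫ ω, X ω * Y ω ∂P + ∫ ω, Y ω ^ 2 ∂P := by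
    rw [← integral_const_mul, ← integral_add j1 j2, ← integral_add j4 j3]
    congr 1; ext ω; ring
  have q2 : ∫ ω, (X ω - Y ω) ^ 2 ∂P =
      ∫ ω, X ω ^ 2 ∂P - 2 * ∫ ω, X ω * Y ω ∂P + ∫ ω, Y ω ^ 2 ∂P := by
    rw [← integral_const_mul, ← integral_sub j1 j2, ← integral_add j5 j3]
    congr 1; ext ω; ring
  have k1 : Integrable (fun ω => (X ω + Y ω) ^ 4) P := i4 (hX.add hY)
  have k2 : Integrable (fun ω => (X ω - Y ω) ^ 4) P := i4 (hX.sub hY)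
  have k3 : Integrable (fun ω => (X ω + Y ω) ^ 4 + (X ω - Y ω) ^ 4) P := k1.add k2
  have k4 : Integrable (fun ω => 2 * X ω ^ 4) P := (i4 hX).const_mul 2
  have k5 : Integrable (fun ω => 2 * Y ω ^ 4) P := (i4 hY).const_mul 2
  have k6 : Integrable (fun ω => (X ω + Y ω) ^ 4 + (X ω - Y ω) ^ 4 - 2 * X ω ^ 4) P := k3.sub k4
  -- Polarization: `(X+Y)⁴ + (X-Y)⁴ = 2X⁴ + 12X²Y² + 2Y⁴`. Here `X ± Y` are again integrals of the
  -- field, so one-dimensional fourth moments suffice.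
  have e : ∫ ω, X ω ^ 2 * Y ω ^ 2 ∂P = (1 / 12) * (∫ ω, (X ω + Y ω) ^ 4 ∂P +
      ∫ ω, (X ω - Y ω) ^ 4 ∂P - 2 * ∫ ω, X ω ^ 4 ∂P - 2 * ∫ ω, Y ω ^ 4 ∂P) := by
    rw [← integral_const_mul 2, ← integral_const_mul 2, ← integral_add k1 k2,
      ← integral_sub k3 k4, ← integral_sub k6 k5, ← integral_const_mul]
    congr 1; ext ω; ring
  rw [e, a, b, c, d, q1, q2]
  ring

end SecondOrder

section Covariances

/-! ### Covariances of the harmonic components -/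

/-- The real and imaginary parts of the spherical harmonics. -/
def realHarmonic (l : ℕ) (p : ℤ × Bool) (x : S2) : ℝ :=
  if p.2 then (sphericalHarmonic l p.1 x).re else (sphericalHarmonic l p.1 x).im

/-- The indices of the real harmonics of degree `l`. -/
def harmonicIndex (l : ℕ) : Finset (ℤ × Bool) := Finset.Icc (-(l : ℤ)) l ×ˢ Finset.univ

/-- The indices of the real harmonics of degree less than `M`. -/
def harmonicIndexLT (M : ℕ) : Finset (Σ _ : ℕ, ℤ × Bool) := (Finset.range M).sigma harmonicIndex

/-- The Legendre kernel `(2l+1)/(4π) P_l(⟨w, y⟩)`. -/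
def legendreKernel (l : ℕ) (y w : S2) : ℝ :=
  (2 * l + 1) / (4 * Real.pi) * (legendre l).eval (inner ℝ w.1 y.1)

lemma continuous_realHarmonic (l : ℕ) (p : ℤ × Bool) : Continuous (realHarmonic l p) := by
  unfold realHarmonic
  split_ifs
  · exact Complex.continuous_re.comp (continuous_sphericalHarmonic l p.1)
  · exact Complex.continuous_im.comp (continuous_sphericalHarmonic l p.1)

lemma continuous_legendreKernel (l : ℕ) (y : S2) : Continuous (legendreKernel l y) :=
  continuous_const.mul (continuous_legendre_inner l y)

lemma legendreKernel_rotate (R : EuclideanSpace ℝ (Fin 3) ≃ₗᵢ[ℝ] EuclideanSpace ℝ (Fin 3))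
    (l : ℕ) (x y : S2) : legendreKernel l (rotate R x) (rotate R y) = legendreKernel l x y := by
  rw [legendreKernel, inner_rotate, legendreKernel]

lemma sum_harmonicIndex {M : Type*} [AddCommMonoid M] (l : ℕ) (F : ℤ × Bool → M) :
    ∑ p ∈ harmonicIndex l, F p =
      ∑ m ∈ Finset.Icc (-(l : ℤ)) l, (F (m, true) + F (m, false)) := by
  rw [harmonicIndex, Finset.sum_product]
  simp

/-- The real part of the addition theorem. The family of real and imaginary parts over all `m` is
linearly dependent, but this identity is all that is needed of it. -/
lemma sum_realHarmonic_mul (l : ℕ) (x y : S2) :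
    ∑ p ∈ harmonicIndex l, realHarmonic l p x * realHarmonic l p y = legendreKernel l x y := by
  have h := congrArg Complex.re (sum_sphericalHarmonic_mul_conj l y x)
  rw [Complex.ofReal_re, Complex.re_sum] at h
  rw [legendreKernel, ← h, sum_harmonicIndex]
  refine Finset.sum_congr rfl fun m _ => ?_
  simp [realHarmonic]
  ring

variable {Ω : Type*} [MeasurableSpace Ω] {P : Measure Ω} [IsProbabilityMeasure P]
  {T : S2 → Ω → ℝ}

/-- The covariance function of a centred field. -/
def covarianceKernel (T : S2 → Ω → ℝ) (P : Measure Ω) (x y : S2) : ℝ := ∫ ω, T x ω * T y ω ∂P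

lemma covarianceKernel_comm (x y : S2) : covarianceKernel T P x y = covarianceKernel T P y x := by
  simp only [covarianceKernel, mul_comm]

namespace IsGaussianIsotropicField

lemma rotationInvariant_covarianceKernel (hT : IsGaussianIsotropicField T P) :
    RotationInvariant (covarianceKernel T P) := by
  intro R hR x y
  have h := hT.isotropic R hR 2 ![x, y]
  have h2 := h.comp (u := fun v : Fin 2 → ℝ => v 0 * v 1) (by fun_prop)
  exact h2.integral_eq

lemma isSecondOrderField (hT : IsGaussianIsotropicField T P) : IsSecondOrderField T P where
  measurable := hT.measurable
  memLp x := (hT.gaussian.hasGaussianLaw_eval x).memLp_two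
  bounded := by
    -- By isotropy the variance is the same at every point.
    refine ⟨covarianceKernel T P northPole northPole, fun x => ?_⟩
    obtain ⟨R, hR, hN⟩ := exists_rotate_eq_northPole x
    rw [← hN, hT.rotationInvariant_covarianceKernel R hR]
    simp only [covarianceKernel, sq, le_refl]

lemma integrable_covarianceKernel (hT : IsGaussianIsotropicField T P) (x : S2) :
    Integrable (covarianceKernel T P x) surfaceMeasure := by
  have h := ((hT.isSecondOrderField.memLp x).comp_snd surfaceMeasure).integrable_mul
    (hT.isSecondOrderField.memLp_prod (μ := surfaceMeasure))
  exact h.integral_prod_left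

lemma integral_covarianceKernel_mul_legendreKernel (hT : IsGaussianIsotropicField T P) (l : ℕ)
    (x y : S2) :
    ∫ w, covarianceKernel T P x w * legendreKernel l y w ∂surfaceMeasure = legendreKernel l y x *
      ∫ w, covarianceKernel T P northPole w * (legendre l).eval (w.1 2) ∂surfaceMeasure := by
  simp only [legendreKernel, mul_left_comm (covarianceKernel T P x _), integral_const_mul]
  rw [funkHecke hT.rotationInvariant_covarianceKernel (hT.integrable_covarianceKernel _)]
  ring

end IsGaussianIsotropicField

lemma harmonicCoeff_eq {l : ℕ} {m : ℤ} {ω : Ω} (hω : Integrable (fun x => T x ω) surfaceMeasure) :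
    harmonicCoeff T l m ω = fieldIntegral surfaceMeasure T (realHarmonic l (m, true)) ω -
      Complex.I * fieldIntegral surfaceMeasure T (realHarmonic l (m, false)) ω := by
  have h : ∀ x, (T x ω : ℂ) * (starRingEnd ℂ) (sphericalHarmonic l m x) =
      ((T x ω * realHarmonic l (m, true) x : ℝ) : ℂ) -
        Complex.I * ((T x ω * realHarmonic l (m, false) x : ℝ) : ℂ) := by
    intro x
    apply Complex.ext <;> simp [realHarmonic]
  have hi : ∀ p, Integrable (fun x => ((T x ω * realHarmonic l p x : ℝ) : ℂ)) surfaceMeasure :=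
    fun p => (integrable_field_mul hω (continuous_realHarmonic l p)).ofReal
  simp only [harmonicCoeff, h, fieldIntegral]
  rw [integral_sub (hi _) ((hi _).const_mul _), integral_const_mul, integral_complex_ofReal,
    integral_complex_ofReal]

lemma fourierComponent_eq_sum {l : ℕ} (x : S2) {ω : Ω}
    (hω : Integrable (fun x => T x ω) surfaceMeasure) :
    fourierComponent T l x ω = ∑ p ∈ harmonicIndex l,
      realHarmonic l p x * fieldIntegral surfaceMeasure T (realHarmonic l p) ω := by
  rw [fourierComponent, Complex.re_sum, sum_harmonicIndex]
  refine Finset.sum_congr rfl fun m _ => ?_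
  rw [harmonicCoeff_eq hω]
  simp [realHarmonic]
  ring

/-- The angular power spectrum is the Funk-Hecke eigenvalue of the covariance. -/
lemma powerSpectrum_eq (hT : IsGaussianIsotropicField T P) (l : ℕ) :
    powerSpectrum T P l =
      ∫ w, covarianceKernel T P northPole w * (legendre l).eval (w.1 2) ∂surfaceMeasure := by
  have hU := hT.isSecondOrderField
  have hφ := continuous_realHarmonic l
  set I : ℤ × Bool → Ω → ℝ := fun p => fieldIntegral surfaceMeasure T (realHarmonic l p) with hI
  have hIL : ∀ p, MemLp (I p) 2 P := fun p => hU.memLp_fieldIntegral (hφ p)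
  have hnorm : ∀ m : ℤ, ∫ ω, ‖harmonicCoeff T l m ω‖ ^ 2 ∂P =
      ∫ ω, I (m, true) ω ^ 2 ∂P + ∫ ω, I (m, false) ω ^ 2 ∂P := by
    intro m
    rw [← integral_add (hIL _).integrable_sq (hIL _).integrable_sq]
    refine integral_congr_ae ?_
    filter_upwards [hU.ae_integrable (μ := surfaceMeasure)] with ω hω
    rw [harmonicCoeff_eq hω, Complex.sq_norm, Complex.normSq_apply]
    simp [hI]
    ring
  have hsum : ∑ m ∈ Finset.Icc (-(l : ℤ)) l, ∫ ω, ‖harmonicCoeff T l m ω‖ ^ 2 ∂P =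
      ∑ p ∈ harmonicIndex l, ∫ ω, I p ω ^ 2 ∂P := by
    rw [sum_harmonicIndex]
    exact Finset.sum_congr rfl fun m _ => hnorm m
  have hterm : ∀ p, ∫ ω, I p ω ^ 2 ∂P =
      ∫ x, (∫ ω, I p ω * T x ω ∂P) * realHarmonic l p x ∂surfaceMeasure := by
    intro p
    rw [← hU.integral_mul_fieldIntegral (hφ p) (hIL p)]
    simp only [hI, sq]
  have hint : ∀ p, Integrable (fun x => (∫ ω, I p ω * T x ω ∂P) * realHarmonic l p x)
      surfaceMeasure := by
    intro p
    have h := ((hIL p).comp_snd surfaceMeasure).integrable_mul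
      (hU.memLp_prod (μ := surfaceMeasure))
    exact integrable_field_mul h.integral_prod_left (hφ p)
  -- The sum of the `E|a_{lm}|²` is the integral over `x` of `E[T(x) T_l(x)]`, which by Funk-Hecke
  -- is the constant `(2l+1)/(4π)` times the eigenvalue. Thus the average over `m` is computed
  -- without comparing different `m`.
  have hx : ∀ x, ∑ p ∈ harmonicIndex l, (∫ ω, I p ω * T x ω ∂P) * realHarmonic l p x =
      (2 * l + 1) / (4 * Real.pi) *
      ∫ w, covarianceKernel T P northPole w * (legendre l).eval (w.1 2) ∂surfaceMeasure := by
    intro x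
    have h1 : ∀ p ∈ harmonicIndex l, Integrable (fun ω => T x ω * (realHarmonic l p x * I p ω)) P :=
      fun p _ => (hU.memLp x).integrable_mul ((hIL p).const_mul _)
    have h2 : ∑ p ∈ harmonicIndex l, (∫ ω, I p ω * T x ω ∂P) * realHarmonic l p x =
        ∫ ω, T x ω * fieldIntegral surfaceMeasure T (legendreKernel l x) ω ∂P := by
      have h3 : ∫ ω, T x ω * fieldIntegral surfaceMeasure T (legendreKernel l x) ω ∂P =
          ∫ ω, ∑ p ∈ harmonicIndex l, T x ω * (realHarmonic l p x * I p ω) ∂P := by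
        refine integral_congr_ae ?_
        filter_upwards [hU.ae_integrable (μ := surfaceMeasure)] with ω hω
        rw [← Finset.mul_sum, ← fieldIntegral_sum _ hφ _ hω]
        simp only [sum_realHarmonic_mul]
      rw [h3, integral_finsetSum _ h1]
      refine Finset.sum_congr rfl fun p _ => ?_
      rw [← integral_mul_const]
      congr 1; ext ω; ring
    rw [h2, hU.integral_mul_fieldIntegral (continuous_legendreKernel l x) (hU.memLp x)]
    refine (hT.integral_covarianceKernel_mul_legendreKernel l x x).trans ?_
    have hxx : inner ℝ x.1 x.1 = (1 : ℝ) := by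
      rw [real_inner_self_eq_norm_sq]; simp
    rw [legendreKernel, hxx, legendre_eval_one, mul_one]
  rw [powerSpectrum, hsum]
  simp only [hterm]
  rw [← integral_finsetSum _ fun p _ => hint p]
  simp only [hx]
  rw [integral_const, surfaceMeasure_univ, smul_eq_mul]
  have := Real.pi_pos
  field_simp

lemma integral_legendreKernel_mul (l m : ℕ) (x y : S2) :
    ∫ w, legendreKernel l x w * legendreKernel m y w ∂surfaceMeasure =
      if l = m then legendreKernel l x y else 0 := by
  have h := integral_legendre_inner_mul l m x y
  have e : ∀ w : S2, legendreKernel l x w * legendreKernel m y w =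
      ((2 * l + 1) / (4 * Real.pi) * ((2 * m + 1) / (4 * Real.pi))) *
        ((legendre l).eval (inner ℝ x.1 w.1) * (legendre m).eval (inner ℝ w.1 y.1)) := by
    intro w
    simp only [legendreKernel]
    rw [real_inner_comm x.1 w.1]
    ring
  simp only [e, integral_const_mul, h]
  split_ifs with hlm
  · subst hlm
    rw [legendreKernel, real_inner_comm]
    have := Real.pi_pos
    field_simp
  · simp

lemma integrable_legendreKernel_mul (l m : ℕ) (x y : S2) :
    Integrable (fun w => legendreKernel l x w * legendreKernel m y w) surfaceMeasure := by
  have := integrable_mul_continuous (integrable_const (1 : ℝ))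
    ((continuous_legendreKernel l x).mul (continuous_legendreKernel m y))
  simpa using this

/-! ### Band-limited fields -/

/-- The kernel `∑_{l<M} a_l (2l+1)/(4π) P_l(⟨w, y⟩)`. -/
def bandKernel (a : ℕ → ℝ) (M : ℕ) (y w : S2) : ℝ :=
  ∑ l ∈ Finset.range M, a l * legendreKernel l y w

lemma continuous_bandKernel (a : ℕ → ℝ) (M : ℕ) (y : S2) : Continuous (bandKernel a M y) :=
  continuous_finsetSum _ fun l _ => continuous_const.mul (continuous_legendreKernel l y)

lemma bandKernel_rotate (R : EuclideanSpace ℝ (Fin 3) ≃ₗᵢ[ℝ] EuclideanSpace ℝ (Fin 3))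
    (a : ℕ → ℝ) (M : ℕ) (x y : S2) :
    bandKernel a M (rotate R x) (rotate R y) = bandKernel a M x y := by
  simp only [bandKernel, legendreKernel_rotate]

lemma integral_bandKernel_mul (a c : ℕ → ℝ) (M : ℕ) (x y : S2) :
    ∫ w, bandKernel a M x w * bandKernel c M y w ∂surfaceMeasure =
      bandKernel (fun l => a l * c l) M x y := by
  have e : ∀ w, bandKernel a M x w * bandKernel c M y w = ∑ l ∈ Finset.range M,
      ∑ m ∈ Finset.range M, (a l * c m) * (legendreKernel l x w * legendreKernel m y w) := by
    intro w
    rw [bandKernel, bandKernel, Finset.sum_mul_sum]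
    refine Finset.sum_congr rfl fun l _ => Finset.sum_congr rfl fun m _ => ?_
    ring
  simp only [e]
  have hi : ∀ l m, Integrable (fun w => (a l * c m) * (legendreKernel l x w * legendreKernel m y w))
    surfaceMeasure := fun l m => (integrable_legendreKernel_mul l m x y).const_mul _
  rw [integral_finsetSum _ fun l _ => integrable_finsetSum _ fun m _ => hi l m, bandKernel]
  refine Finset.sum_congr rfl fun l hl => ?_
  rw [integral_finsetSum _ fun m _ => hi l m]
  simp only [integral_const_mul, integral_legendreKernel_mul]
  simp only [mul_ite, mul_zero]
  rw [Finset.sum_ite_eq, if_pos hl]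

/-- Band-limited kernels under a rotation invariant kernel. -/
lemma integral_mul_bandKernel {G : S2 → S2 → ℝ} (hG : RotationInvariant G)
    (hi : ∀ x, Integrable (G x) surfaceMeasure) (a : ℕ → ℝ) (M : ℕ) (x y : S2) :
    ∫ w, G x w * bandKernel a M y w ∂surfaceMeasure = bandKernel (fun l => a l *
      ∫ w, G northPole w * (legendre l).eval (w.1 2) ∂surfaceMeasure) M y x := by
  simp only [bandKernel, Finset.mul_sum]
  have h : ∀ l ∈ Finset.range M,
      Integrable (fun w => G x w * (a l * legendreKernel l y w)) surfaceMeasure := fun l _ =>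
    integrable_mul_continuous (hi x) (continuous_const.mul (continuous_legendreKernel l y))
  rw [integral_finsetSum _ h]
  refine Finset.sum_congr rfl fun l _ => ?_
  simp only [legendreKernel, mul_left_comm (G x _), integral_const_mul]
  rw [funkHecke hG (hi _)]
  ring

/-- The field `∑_{l<M} a_l T_l(y)`, in terms of real harmonics. -/
def bandField (T : S2 → Ω → ℝ) (a : ℕ → ℝ) (M : ℕ) (y : S2) (ω : Ω) : ℝ :=
  ∑ i ∈ harmonicIndexLT M, (a i.1 * realHarmonic i.1 i.2 y) *
    fieldIntegral surfaceMeasure T (realHarmonic i.1 i.2) ω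

lemma bandField_eq_sum_fourierComponent (a : ℕ → ℝ) (M : ℕ) (y : S2) {ω : Ω}
    (hω : Integrable (fun x => T x ω) surfaceMeasure) :
    bandField T a M y ω = ∑ l ∈ Finset.range M, a l * fourierComponent T l y ω := by
  rw [bandField, harmonicIndexLT, Finset.sum_sigma]
  refine Finset.sum_congr rfl fun l _ => ?_
  rw [fourierComponent_eq_sum y hω, Finset.mul_sum]
  simp only [mul_assoc]

lemma bandKernel_eq_sum (a : ℕ → ℝ) (M : ℕ) (y w : S2) : bandKernel a M y w =
    ∑ i ∈ harmonicIndexLT M, (a i.1 * realHarmonic i.1 i.2 y) * realHarmonic i.1 i.2 w := by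
  rw [harmonicIndexLT, Finset.sum_sigma]
  refine Finset.sum_congr rfl fun l _ => ?_
  rw [← sum_realHarmonic_mul, Finset.mul_sum]
  simp only [mul_assoc]

/-- Exhibits the band-limited field as a linear functional of `T`, which is how it inherits
Gaussianity. -/
lemma bandField_eq_fieldIntegral (a : ℕ → ℝ) (M : ℕ) (y : S2) {ω : Ω}
    (hω : Integrable (fun x => T x ω) surfaceMeasure) :
    bandField T a M y ω = fieldIntegral surfaceMeasure T (bandKernel a M y) ω := by
  rw [bandField, ← fieldIntegral_sum (F := fun i : (Σ _ : ℕ, ℤ × Bool) => realHarmonic i.1 i.2) _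
    (fun i => continuous_realHarmonic i.1 i.2) _ hω]
  simp only [← bandKernel_eq_sum]

lemma bandField_ae_eq (hT : IsGaussianIsotropicField T P) (a : ℕ → ℝ) (M : ℕ) (y : S2) :
    bandField T a M y =ᵐ[P] fieldIntegral surfaceMeasure T (bandKernel a M y) := by
  filter_upwards [hT.isSecondOrderField.ae_integrable (μ := surfaceMeasure)] with ω hω
  exact bandField_eq_fieldIntegral a M y hω

/-- The covariance of `T` acts on Legendre kernels by `C_l` (Funk-Hecke), and the reproducing
property composes the two remaining band kernels. -/
lemma integral_bandField_mul (hT : IsGaussianIsotropicField T P) (a : ℕ → ℝ) (M : ℕ)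
    (x y : S2) : ∫ ω, bandField T a M x ω * bandField T a M y ω ∂P =
      bandKernel (fun l => a l ^ 2 * powerSpectrum T P l) M x y := by
  refine Eq.trans (integral_congr_ae ((bandField_ae_eq hT a M x).mul (bandField_ae_eq hT a M y))) ?_
  refine (hT.isSecondOrderField.integral_fieldIntegral_mul (continuous_bandKernel a M x)
    (continuous_bandKernel a M y)).trans ?_
  have h : ∀ z, ∫ w, (∫ ω, T w ω * T z ω ∂P) * bandKernel a M x w ∂surfaceMeasure =
      bandKernel (fun l => a l * powerSpectrum T P l) M x z := by
    intro z
    simp only [powerSpectrum_eq hT]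
    rw [← integral_mul_bandKernel hT.rotationInvariant_covarianceKernel
      hT.integrable_covarianceKernel]
    congr 1; ext w
    rw [covarianceKernel_comm, covarianceKernel]
  simp only [h]
  rw [integral_bandKernel_mul]
  congr 1; ext l; ring

lemma measurable_bandField (hT : IsGaussianIsotropicField T P) (a : ℕ → ℝ) (M : ℕ) :
    Measurable (fun p : S2 × Ω => bandField T a M p.1 p.2) := by
  unfold bandField
  refine Finset.measurable_sum _ fun i _ => ?_
  exact (measurable_const.mul ((continuous_realHarmonic i.1 i.2).measurable.comp
    measurable_fst)).mul ((hT.isSecondOrderField.stronglyMeasurable_fieldIntegral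
      (continuous_realHarmonic i.1 i.2)).measurable.comp measurable_snd)

/-- The second Hermite polynomial of a normalized band-limited field. -/
def hermiteField (T : S2 → Ω → ℝ) (a : ℕ → ℝ) (M : ℕ) (y : S2) (ω : Ω) : ℝ :=
  bandField T a M y ω ^ 2 - 1

/-! ### Moments and covariance of the second Hermite polynomial of the field. -/

section Hermite

variable {a : ℕ → ℝ} {M : ℕ}

lemma memLp_four_bandField (hT : IsGaussianIsotropicField T P) (y : S2) :
    MemLp (bandField T a M y) 4 P :=
  (memLp_four_fieldIntegral hT.isSecondOrderField hT.gaussian hT.zero_mean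
    (continuous_bandKernel a M y)).ae_eq (bandField_ae_eq hT a M y).symm

lemma memLp_hermiteField (hT : IsGaussianIsotropicField T P) (y : S2) :
    MemLp (hermiteField T a M y) 2 P := by
  have h : MemLp (fun ω => bandField T a M y ω * bandField T a M y ω) 2 P := by
    -- Hölder's inequality with `1/4 + 1/4 = 1/2`: the square of an `L⁴` variable is in `L²`.
    have : ENNReal.HolderTriple 4 4 2 := ⟨by
      rw [show (4 : ENNReal) = 2 * 2 by norm_num, ENNReal.mul_inv (by simp) (by simp), ← two_mul,
        ← mul_assoc, ENNReal.mul_inv_cancel (by simp) (by simp), one_mul]⟩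
    exact (memLp_four_bandField hT y).mul' (memLp_four_bandField hT y)
  refine (h.sub (memLp_const (1 : ℝ))).ae_eq (Filter.Eventually.of_forall fun ω => ?_)
  simp [hermiteField, sq]

lemma integrable_bandField_sq (hT : IsGaussianIsotropicField T P) (y : S2) :
    Integrable (fun ω => bandField T a M y ω ^ 2) P := by
  have h := (memLp_hermiteField (a := a) (M := M) hT y).integrable one_le_two
  refine (h.add (integrable_const (1 : ℝ))).congr (Filter.Eventually.of_forall fun ω => ?_)
  simp [hermiteField]

lemma integral_hermiteField (hT : IsGaussianIsotropicField T P)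
    (hvar : ∀ x, ∫ ω, bandField T a M x ω ^ 2 ∂P = 1) (y : S2) :
    ∫ ω, hermiteField T a M y ω ∂P = 0 := by
  simp only [hermiteField]
  rw [integral_sub (integrable_bandField_sq hT y) (integrable_const _), hvar]
  simp

/-- Wick's formula at unit variance gives `E X²Y² = 1 + 2(E XY)²`; the terms `-X² - Y² + 1`
contribute `-1`. -/
lemma integral_hermiteField_mul (hT : IsGaussianIsotropicField T P)
    (hvar : ∀ x, ∫ ω, bandField T a M x ω ^ 2 ∂P = 1) (x y : S2) :
    ∫ ω, hermiteField T a M x ω * hermiteField T a M y ω ∂P =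
      2 * bandKernel (fun l => a l ^ 2 * powerSpectrum T P l) M x y ^ 2 := by
  have hx := bandField_ae_eq hT a M x
  have hy := bandField_ae_eq hT a M y
  have h := integral_sq_mul_sq_fieldIntegral hT.isSecondOrderField hT.gaussian hT.zero_mean
    (μ := surfaceMeasure) (continuous_bandKernel a M x) (continuous_bandKernel a M y)
  have h1 : ∫ ω, bandField T a M x ω ^ 2 * bandField T a M y ω ^ 2 ∂P =
      1 + 2 * bandKernel (fun l => a l ^ 2 * powerSpectrum T P l) M x y ^ 2 := by
    rw [← integral_bandField_mul hT, ← one_mul (1 : ℝ)]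
    nth_rw 1 [← hvar x]
    rw [← hvar y]
    have e1 := integral_congr_ae (hx.pow_const 2)
    have e2 := integral_congr_ae (hy.pow_const 2)
    have e3 := integral_congr_ae (hx.mul hy)
    have e4 := integral_congr_ae ((hx.pow_const 2).mul (hy.pow_const 2))
    simp only [Pi.mul_apply, Pi.pow_apply] at e1 e2 e3 e4
    rw [e1, e2, e3, e4]
    exact h
  have i1 := integrable_bandField_sq (a := a) (M := M) hT x
  have i2 := integrable_bandField_sq (a := a) (M := M) hT y
  have i3 : Integrable (fun ω => hermiteField T a M x ω * hermiteField T a M y ω) P :=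
    (memLp_hermiteField hT x).integrable_mul (memLp_hermiteField hT y)
  have i4 : Integrable (fun ω => hermiteField T a M x ω * hermiteField T a M y ω +
    bandField T a M x ω ^ 2) P := i3.add i1
  have i5 : Integrable (fun ω => hermiteField T a M x ω * hermiteField T a M y ω +
    bandField T a M x ω ^ 2 + bandField T a M y ω ^ 2) P := i4.add i2
  have h2 : ∫ ω, bandField T a M x ω ^ 2 * bandField T a M y ω ^ 2 ∂P =
      ∫ ω, hermiteField T a M x ω * hermiteField T a M y ω ∂P +
        ∫ ω, bandField T a M x ω ^ 2 ∂P + ∫ ω, bandField T a M y ω ^ 2 ∂P - ∫ _, (1 : ℝ) ∂P := by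
    rw [← integral_add i3 i1, ← integral_add i4 i2, ← integral_sub i5 (integrable_const _)]
    congr 1; ext ω; simp only [hermiteField]; ring
  rw [h1, hvar, hvar] at h2
  simp at h2
  linarith

lemma isSecondOrderField_hermiteField (hT : IsGaussianIsotropicField T P)
    (hvar : ∀ x, ∫ ω, bandField T a M x ω ^ 2 ∂P = 1) :
    IsSecondOrderField (hermiteField T a M) P where
  measurable := ((measurable_bandField hT a M).pow_const 2).sub measurable_const
  memLp y := memLp_hermiteField hT y
  bounded := by
    -- `E H₂(X)² = 2` for a standard Gaussian.
    refine ⟨2, fun x => ?_⟩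
    simp only [sq (hermiteField T a M x _)]
    rw [integral_hermiteField_mul hT hvar, ← integral_bandField_mul hT]
    simp only [← sq, hvar]
    norm_num

/-- The covariance of a smoothed quadratic functional of a band-limited field. -/
lemma integral_fieldIntegral_hermiteField_mul (hT : IsGaussianIsotropicField T P)
    (hvar : ∀ x, ∫ ω, bandField T a M x ω ^ 2 ∂P = 1) (κ : ℕ → ℝ) (N : ℕ) (x₁ x₂ : S2) :
    ∫ ω, fieldIntegral surfaceMeasure (hermiteField T a M) (bandKernel κ N x₁) ω *
      fieldIntegral surfaceMeasure (hermiteField T a M) (bandKernel κ N x₂) ω ∂P =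
    2 * ∑ l ∈ Finset.range N, κ l ^ 2 * ((2 * l + 1) / (4 * Real.pi)) *
      (∑ l₁ ∈ Finset.range M, ∑ l₂ ∈ Finset.range M, a l₁ ^ 2 * a l₂ ^ 2 *
        ((2 * l₁ + 1) * (2 * l₂ + 1) / (4 * Real.pi)) * powerSpectrum T P l₁ *
          powerSpectrum T P l₂ * wigner3j l l₁ l₂ 0 0 0 ^ 2) *
        (legendre l).eval (inner ℝ x₁.1 x₂.1) := by
  set c : ℕ → ℝ := fun l => a l ^ 2 * powerSpectrum T P l with hc
  rw [(isSecondOrderField_hermiteField hT hvar).integral_fieldIntegral_mul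
    (continuous_bandKernel κ N x₁) (continuous_bandKernel κ N x₂)]
  have hG : RotationInvariant fun x y => 2 * bandKernel c M x y ^ 2 := fun R hR x y => by
    simp only [bandKernel_rotate]
  have hi : ∀ x, Integrable (fun y => 2 * bandKernel c M x y ^ 2) surfaceMeasure := fun x => by
    simpa using integrable_mul_continuous (integrable_const (1 : ℝ))
      (continuous_const.mul ((continuous_bandKernel c M x).pow 2))
  -- The first smoothing: the kernel `2ρ²` is rotation invariant, so it acts on each Legendre
  -- component by a scalar.
  have hinner : ∀ y, ∫ x, (∫ ω, hermiteField T a M x ω * hermiteField T a M y ω ∂P) *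
      bandKernel κ N x₁ x ∂surfaceMeasure = bandKernel (fun l => κ l *
      ∫ w, (2 * bandKernel c M northPole w ^ 2) * (legendre l).eval (w.1 2) ∂surfaceMeasure)
        N x₁ y := by
    intro y
    rw [← integral_mul_bandKernel hG hi]
    congr 1; ext x
    simp only [mul_comm (hermiteField T a M x _)]
    rw [integral_hermiteField_mul hT hvar]
  simp only [hinner]
  rw [integral_bandKernel_mul, bandKernel, Finset.mul_sum]
  refine Finset.sum_congr rfl fun l _ => ?_
  -- The eigenvalue of `2ρ²`: expanding the square gives triple products. Of the two factors
  -- `1/(4π)`, one is cancelled by the `4π` from `integral_legendre_triple`.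
  have hmu : ∫ w, (2 * bandKernel c M northPole w ^ 2) * (legendre l).eval (w.1 2)
      ∂surfaceMeasure = 2 * ∑ l₁ ∈ Finset.range M, ∑ l₂ ∈ Finset.range M, a l₁ ^ 2 * a l₂ ^ 2 *
        ((2 * l₁ + 1) * (2 * l₂ + 1) / (4 * Real.pi)) * powerSpectrum T P l₁ *
          powerSpectrum T P l₂ * wigner3j l l₁ l₂ 0 0 0 ^ 2 := by
    have e : ∀ w : S2, (2 * bandKernel c M northPole w ^ 2) * (legendre l).eval (w.1 2) =
        ∑ l₁ ∈ Finset.range M, ∑ l₂ ∈ Finset.range M, (2 * (c l₁ * c l₂) *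
          ((2 * l₁ + 1) / (4 * Real.pi) * ((2 * l₂ + 1) / (4 * Real.pi)))) *
          ((legendre l).eval (w.1 2) * (legendre l₁).eval (w.1 2) *
            (legendre l₂).eval (w.1 2)) := by
      intro w
      rw [bandKernel, sq, Finset.sum_mul_sum]
      simp only [Finset.mul_sum, Finset.sum_mul]
      refine Finset.sum_congr rfl fun l₁ _ => Finset.sum_congr rfl fun l₂ _ => ?_
      simp only [legendreKernel, inner_northPole]
      ring
    have hint : ∀ l₁ l₂ : ℕ, Integrable (fun w : S2 => (2 * (c l₁ * c l₂) *
          ((2 * l₁ + 1) / (4 * Real.pi) * ((2 * l₂ + 1) / (4 * Real.pi)))) *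
          ((legendre l).eval (w.1 2) * (legendre l₁).eval (w.1 2) *
            (legendre l₂).eval (w.1 2))) surfaceMeasure := fun l₁ l₂ => by
      have hp : ∀ n, Continuous fun w : S2 => (legendre n).eval (w.1 2) := fun n =>
        (legendre n).continuous.comp (continuous_coord 2)
      simpa using integrable_mul_continuous (integrable_const (2 * (c l₁ * c l₂) *
          ((2 * l₁ + 1) / (4 * Real.pi) * ((2 * l₂ + 1) / (4 * Real.pi)))))
        (((hp l).mul (hp l₁)).mul (hp l₂))
    simp only [e]
    rw [integral_finsetSum _ fun l₁ _ => integrable_finsetSum _ fun l₂ _ => hint l₁ l₂,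
      Finset.mul_sum]
    refine Finset.sum_congr rfl fun l₁ _ => ?_
    rw [integral_finsetSum _ fun l₂ _ => hint l₁ l₂, Finset.mul_sum]
    refine Finset.sum_congr rfl fun l₂ _ => ?_
    rw [integral_const_mul, integral_legendre_triple, hc]
    have := Real.pi_pos
    field_simp
  rw [hmu, legendreKernel, real_inner_comm]
  ring

end Hermite

end Covariances

/-! ### Smoothed quadratic functionals and their isotropy -/

section Smoothing

variable {Ω : Type*} [MeasurableSpace Ω] {P : Measure Ω} [IsProbabilityMeasure P]
  {T : S2 → Ω → ℝ}

/-- The smoothed quadratic functional, in terms of the harmonic coefficients of the field. -/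
def quadraticFunctional (κ a : ℕ → ℝ) (N M : ℕ) (x : S2) (v : harmonicIndexLT M → ℝ) : ℝ :=
  ∫ y, ((∑ i : harmonicIndexLT M, (a i.1.1 * realHarmonic i.1.1 i.1.2 y) * v i) ^ 2 - 1) *
    bandKernel κ N x y ∂surfaceMeasure

/-- Needed to transport equality in law from the coefficient vector to the smoothed field. -/
lemma measurable_quadraticFunctional (κ a : ℕ → ℝ) (N M : ℕ) (x : S2) :
    Measurable (quadraticFunctional κ a N M x) := by
  have h : Continuous fun p : S2 × (harmonicIndexLT M → ℝ) =>
      ((∑ i : harmonicIndexLT M, (a i.1.1 * realHarmonic i.1.1 i.1.2 p.1) * p.2 i) ^ 2 - 1) *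
        bandKernel κ N x p.1 := by
    have h1 : ∀ i : harmonicIndexLT M, Continuous fun p : S2 × (harmonicIndexLT M → ℝ) =>
        realHarmonic i.1.1 i.1.2 p.1 := fun i =>
      (continuous_realHarmonic i.1.1 i.1.2).comp continuous_fst
    have h2 : Continuous fun p : S2 × (harmonicIndexLT M → ℝ) => bandKernel κ N x p.1 :=
      (continuous_bandKernel κ N x).comp continuous_fst
    fun_prop
  exact h.measurable.stronglyMeasurable.integral_prod_left'.measurable

lemma fieldIntegral_hermiteField (κ a : ℕ → ℝ) (N M : ℕ) (x : S2) (ω : Ω) :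
    fieldIntegral surfaceMeasure (hermiteField T a M) (bandKernel κ N x) ω =
      quadraticFunctional κ a N M x
        fun i => fieldIntegral surfaceMeasure T (realHarmonic i.1.1 i.1.2) ω := by
  rw [fieldIntegral, quadraticFunctional]
  congr 1
  ext y
  rw [hermiteField, bandField, ← Finset.sum_coe_sort]

/-- Since the band kernel at `(R y, w)` equals the one at `(y, R⁻¹ w)`, rotating the point amounts
to rotating the harmonics in the coefficients while the weights stay at `y`. This replaces the
Wigner `D`-matrices. -/
lemma bandField_rotate (R : EuclideanSpace ℝ (Fin 3) ≃ₗᵢ[ℝ] EuclideanSpace ℝ (Fin 3))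
    (a : ℕ → ℝ) (M : ℕ) (y : S2) {ω : Ω} (hω : Integrable (fun x => T x ω) surfaceMeasure) :
    bandField T a M (rotate R y) ω = ∑ i ∈ harmonicIndexLT M, (a i.1 * realHarmonic i.1 i.2 y) *
      fieldIntegral surfaceMeasure T (fun w => realHarmonic i.1 i.2 (rotate R.symm w)) ω := by
  rw [bandField_eq_fieldIntegral a M _ hω, ← fieldIntegral_sum
    (F := fun (i : (Σ _ : ℕ, ℤ × Bool)) w => realHarmonic i.1 i.2 (rotate R.symm w)) _
    (fun i => (continuous_realHarmonic i.1 i.2).comp (continuous_rotate _)) _ hω]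
  congr 1
  ext w
  rw [← bandKernel_eq_sum, ← bandKernel_rotate R a M y, rotate_rotate_symm]

lemma fieldIntegral_hermiteField_rotate
    (R : EuclideanSpace ℝ (Fin 3) ≃ₗᵢ[ℝ] EuclideanSpace ℝ (Fin 3)) (κ a : ℕ → ℝ) (N M : ℕ)
    (x : S2) {ω : Ω} (hω : Integrable (fun x => T x ω) surfaceMeasure) :
    fieldIntegral surfaceMeasure (hermiteField T a M) (bandKernel κ N (rotate R x)) ω =
      quadraticFunctional κ a N M x fun i => fieldIntegral surfaceMeasure T
        (fun w => realHarmonic i.1.1 i.1.2 (rotate R.symm w)) ω := by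
  rw [fieldIntegral, quadraticFunctional, ← integral_rotate R]
  congr 1
  ext y
  rw [hermiteField, bandField_rotate R a M y hω, bandKernel_rotate, ← Finset.sum_coe_sort]

/-- Fubini expresses both sides through the covariance kernel; rotate both integration variables and
use its invariance. -/
lemma integral_fieldIntegral_rotate_mul (hT : IsGaussianIsotropicField T P)
    {R : EuclideanSpace ℝ (Fin 3) ≃ₗᵢ[ℝ] EuclideanSpace ℝ (Fin 3)}
    (hR : LinearMap.det (R.toLinearEquiv :
      EuclideanSpace ℝ (Fin 3) →ₗ[ℝ] EuclideanSpace ℝ (Fin 3)) = 1) {f g : S2 → ℝ}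
    (hf : Continuous f) (hg : Continuous g) :
    ∫ ω, fieldIntegral surfaceMeasure T (fun w => f (rotate R w)) ω *
      fieldIntegral surfaceMeasure T (fun w => g (rotate R w)) ω ∂P =
    ∫ ω, fieldIntegral surfaceMeasure T f ω * fieldIntegral surfaceMeasure T g ω ∂P := by
  refine (hT.isSecondOrderField.integral_fieldIntegral_mul (hf.comp (continuous_rotate R))
    (hg.comp (continuous_rotate R))).trans ?_
  rw [hT.isSecondOrderField.integral_fieldIntegral_mul hf hg]
  conv_rhs => rw [← integral_rotate R]
  congr 1
  ext y
  conv_rhs => rw [← integral_rotate R]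
  congr 2
  ext x
  congr 1
  exact (hT.rotationInvariant_covarianceKernel R hR x y).symm

/-- The values at the original and at the rotated points are the same functions of two Gaussian
vectors with equal covariances, hence equal laws. -/
lemma isIsotropic_fieldIntegral_hermiteField (hT : IsGaussianIsotropicField T P)
    (κ a : ℕ → ℝ) (N M : ℕ) :
    IsIsotropic (fun x => fieldIntegral surfaceMeasure (hermiteField T a M) (bandKernel κ N x))
      P := by
  intro R hR n x
  have hU := hT.isSecondOrderField
  have hφ : ∀ i : harmonicIndexLT M, Continuous (realHarmonic i.1.1 i.1.2) := fun i =>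
    continuous_realHarmonic i.1.1 i.1.2
  have h := identDistrib_fieldIntegral (μ := surfaceMeasure) hU hT.gaussian hT.zero_mean
    (F := fun (i : harmonicIndexLT M) w => realHarmonic i.1.1 i.1.2 (rotate R.symm w))
    (H := fun i => realHarmonic i.1.1 i.1.2)
    (fun i => (hφ i).comp (continuous_rotate _)) hφ
    (fun i k => integral_fieldIntegral_rotate_mul hT (det_symm_eq_one hR) (hφ i) (hφ k))
  have h2 := h.comp (measurable_pi_lambda (fun v k => quadraticFunctional κ a N M (x k) v)
    fun k => measurable_quadraticFunctional κ a N M (x k))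
  have e : (fun ω k => fieldIntegral surfaceMeasure (hermiteField T a M) (bandKernel κ N (x k)) ω) =
      fun ω k => quadraticFunctional κ a N M (x k)
        fun i => fieldIntegral surfaceMeasure T (realHarmonic i.1.1 i.1.2) ω := by
    ext ω k
    exact fieldIntegral_hermiteField κ a N M (x k) ω
  rw [e]
  refine (IdentDistrib.of_ae_eq h2.aemeasurable_fst ?_).symm.trans h2
  filter_upwards [hU.ae_integrable (μ := surfaceMeasure)] with ω hω
  ext k
  exact (fieldIntegral_hermiteField_rotate R κ a N M (x k) hω).symm

/-! ### Needlet fields -/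

lemma smoothingKernel_inner (κ : ℕ → ℝ) (L : ℕ) (x y : S2) :
    smoothingKernel κ L (inner ℝ x.1 y.1) = bandKernel κ (L + 1) x y := by
  rw [smoothingKernel, bandKernel, real_inner_comm]
  refine Finset.sum_congr rfl fun l _ => ?_
  rw [legendreKernel]
  ring

lemma aeval_hermite_two (u : ℝ) : Polynomial.aeval u (Polynomial.hermite 2) = u ^ 2 - 1 := by
  simp [Polynomial.hermite_succ]
  ring

lemma tsum_eq_sum_range {f : ℕ → ℝ} {M : ℕ} (h : ∀ l, M ≤ l → f l = 0) :
    ∑' l, f l = ∑ l ∈ Finset.range M, f l :=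
  tsum_eq_sum fun l hl => h l (by simpa using hl)

lemma needletField_eq_bandField {b : ℝ → ℝ} {B : ℝ} {j M : ℕ}
    (hM : ∀ l : ℕ, M ≤ l → b (l / B ^ j) = 0) (y : S2) {ω : Ω}
    (hω : Integrable (fun x => T x ω) surfaceMeasure) :
    needletField T b B j y ω = bandField T (fun l => b (l / B ^ j)) M y ω := by
  rw [bandField_eq_sum_fourierComponent _ _ _ hω, needletField]
  exact tsum_eq_sum_range fun l hl => by rw [hM l hl, zero_mul]

lemma bandKernel_self (a : ℕ → ℝ) (M : ℕ) (x : S2) :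
    bandKernel a M x x = ∑ l ∈ Finset.range M, a l * ((2 * l + 1) / (4 * Real.pi)) := by
  have hxx : inner ℝ x.1 x.1 = (1 : ℝ) := by
    rw [real_inner_self_eq_norm_sq]; simp
  simp only [bandKernel, legendreKernel, hxx, legendre_eval_one, mul_one]

/-- A needlet field of unit variance is its own normalization. -/
lemma normalizedNeedletField_eq (hT : IsGaussianIsotropicField T P) {b : ℝ → ℝ} {B : ℝ} {j M : ℕ}
    (hM : ∀ l : ℕ, M ≤ l → b (l / B ^ j) = 0)
    (hvar : ∀ x, ∫ ω, bandField T (fun l => b (l / B ^ j)) M x ω ^ 2 ∂P = 1) (x : S2) (ω : Ω) :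
    normalizedNeedletField T P b B j x ω = needletField T b B j x ω := by
  have h := hvar x
  simp only [sq] at h
  rw [integral_bandField_mul hT, bandKernel_self] at h
  rw [normalizedNeedletField, tsum_eq_sum_range (M := M) fun l hl => by rw [hM l hl]; simp]
  simp only [mul_right_comm _ _ (powerSpectrum T P _), h, Real.sqrt_one, div_one]

/-- The hypothesis on `ω` does not involve `x` or `y`; this matters, since the needlet field is
squared and integrated over `y` for fixed `ω`. -/
lemma smoothedTransform_two_eq (hT : IsGaussianIsotropicField T P) {b : ℝ → ℝ} {B : ℝ} {j M : ℕ}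
    (hM : ∀ l : ℕ, M ≤ l → b (l / B ^ j) = 0)
    (hvar : ∀ x, ∫ ω, bandField T (fun l => b (l / B ^ j)) M x ω ^ 2 ∂P = 1) (κ : ℕ → ℝ) (L : ℕ)
    (x : S2) {ω : Ω} (hω : Integrable (fun x => T x ω) surfaceMeasure) :
    smoothedTransform T P b B κ L j 2 x ω = fieldIntegral surfaceMeasure
      (hermiteField T (fun l => b (l / B ^ j)) M) (bandKernel κ (L + 1) x) ω := by
  rw [smoothedTransform, fieldIntegral]
  congr 1
  ext y
  rw [smoothingKernel_inner, aeval_hermite_two, normalizedNeedletField_eq hT hM hvar,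
    needletField_eq_bandField hM y hω, hermiteField, mul_comm]

lemma IsIsotropic.congr_ae {f g : S2 → Ω → ℝ} (hf : IsIsotropic f P)
    (h : ∀ᵐ ω ∂P, ∀ x, f x ω = g x ω) : IsIsotropic g P := by
  intro R hR n x
  have h1 := hf R hR n x
  refine (IdentDistrib.of_ae_eq h1.aemeasurable_fst ?_).symm.trans
    (h1.trans (IdentDistrib.of_ae_eq h1.aemeasurable_snd ?_))
  · filter_upwards [h] with ω hω
    ext k
    exact hω _
  · filter_upwards [h] with ω hω
    ext k
    exact hω _

lemma exists_forall_le_eq_zero {b : ℝ → ℝ} {B : ℝ} (hB : 1 < B)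
    (hb : ∀ t, t ∉ Set.Icc B⁻¹ B → b t = 0) (j : ℕ) :
    ∃ M : ℕ, ∀ l : ℕ, M ≤ l → b (l / B ^ j) = 0 := by
  -- Beyond `B^{j+1}` the argument `l / B^j` exceeds `B`.
  obtain ⟨M, hM⟩ := exists_nat_gt (B * B ^ j)
  refine ⟨M, fun l hl => hb _ fun h => ?_⟩
  have h1 := (div_le_iff₀ (pow_pos (zero_lt_one.trans hB) j)).mp h.2
  have h2 : (M : ℝ) ≤ l := by exact_mod_cast hl
  linarith

end Smoothing

end SphericalField

end

/-! ### Assembly of the theorem. -/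

theorem mainTheorem8 {Ω : Type*} [MeasurableSpace Ω] (P : MeasureTheory.Measure Ω)
    [MeasureTheory.IsProbabilityMeasure P]
    (T : SphericalField.S2 → Ω → ℝ) (hT : SphericalField.IsGaussianIsotropicField T P)
    (B : ℝ) (hB : 1 < B) (b : ℝ → ℝ) (hb : ∀ t, t ∉ Set.Icc B⁻¹ B → b t = 0)
    (κ : ℕ → ℝ) (L : ℕ) (j : ℕ)
    (hvar : ∀ x, ∫ ω, SphericalField.needletField T b B j x ω ^ 2 ∂P = 1) :
    (∀ x, ∫ ω, SphericalField.smoothedTransform T P b B κ L j 2 x ω ∂P = 0) ∧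
    (∀ x, MeasureTheory.MemLp (SphericalField.smoothedTransform T P b B κ L j 2 x) 2 P) ∧
    SphericalField.IsIsotropic (SphericalField.smoothedTransform T P b B κ L j 2) P ∧
    ∀ x₁ x₂ : SphericalField.S2,
      ∫ ω, SphericalField.smoothedTransform T P b B κ L j 2 x₁ ω *
          SphericalField.smoothedTransform T P b B κ L j 2 x₂ ω ∂P =
        2 * ∑ l ∈ Finset.range (L + 1), κ l ^ 2 * ((2 * l + 1) / (4 * Real.pi)) *
          (∑' l₁ : ℕ, ∑' l₂ : ℕ, b (l₁ / B ^ j) ^ 2 * b (l₂ / B ^ j) ^ 2 *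
            ((2 * l₁ + 1) * (2 * l₂ + 1) / (4 * Real.pi)) *
            SphericalField.powerSpectrum T P l₁ * SphericalField.powerSpectrum T P l₂ *
            SphericalField.wigner3j l l₁ l₂ 0 0 0 ^ 2) *
          (SphericalField.legendre l).eval (inner ℝ x₁.1 x₂.1) := by
  open SphericalField in
  obtain ⟨M, hM⟩ := exists_forall_le_eq_zero hB hb j
  have hint := hT.isSecondOrderField.ae_integrable (μ := surfaceMeasure)
  have hvar' : ∀ x, ∫ ω, bandField T (fun l => b (l / B ^ j)) M x ω ^ 2 ∂P = 1 := fun x => by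
    rw [← hvar x]
    refine integral_congr_ae ?_
    filter_upwards [hint] with ω hω
    rw [needletField_eq_bandField hM x hω]
  -- One null set for all `x`, so moments and finite-dimensional laws transfer together.
  have hg : ∀ᵐ ω ∂P, ∀ x, fieldIntegral surfaceMeasure
      (hermiteField T (fun l => b (l / B ^ j)) M) (bandKernel κ (L + 1) x) ω =
        smoothedTransform T P b B κ L j 2 x ω := by
    filter_upwards [hint] with ω hω x
    exact (smoothedTransform_two_eq hT hM hvar' κ L x hω).symm
  have hU := isSecondOrderField_hermiteField hT hvar'
  refine ⟨fun x => ?_, fun x => ?_, ?_, fun x₁ x₂ => ?_⟩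
  · rw [← integral_congr_ae (hg.mono fun ω hω => hω x),
      hU.integral_fieldIntegral (continuous_bandKernel κ (L + 1) x)]
    simp [integral_hermiteField hT hvar']
  · exact (hU.memLp_fieldIntegral (μ := surfaceMeasure) (continuous_bandKernel κ (L + 1) x)).ae_eq
      (hg.mono fun ω hω => hω x)
  · exact (isIsotropic_fieldIntegral_hermiteField hT κ _ (L + 1) M).congr_ae hg
  · rw [← integral_congr_ae (hg.mono fun ω hω => congrArg₂ (· * ·) (hω x₁) (hω x₂)),
      integral_fieldIntegral_hermiteField_mul hT hvar']
    congr 1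
    refine Finset.sum_congr rfl fun l _ => ?_
    congr 2
    -- Both series are finite sums, because `b (l / B ^ j)` vanishes for `l ≥ M`.
    rw [tsum_eq_sum_range (M := M) fun l₁ hl₁ => by simp [hM l₁ hl₁]]
    refine Finset.sum_congr rfl fun l₁ _ => ?_
    rw [tsum_eq_sum_range (M := M) fun l₂ hl₂ => by simp [hM l₂ hl₂]]
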